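/- A conjunctive query (CQ) $Q$ consists of finitely many atoms $R_i(\mathbf X_i)$, where $\mathbf X_i$ is a tuple of variables, and a set $\mathrm{free}(Q)$ of free variables, each of which appears in some atom; it is self-join-free if its relation symbols are pairwise distinct. A database $I$ over the schema of $Q$ assigns to each relation symbol a finite set of tuples of constants of the right arity; $|I|$ is its total number of tuples; constants are natural numbers. An answer in $Q(I)$ is the restriction to $\mathrm{free}(Q)$ of a map from the variables to constants that maps every atom to a tuple of $I$. A weight function $w$ gives a real weight $w_x(c)$ to every value $c$ of every variable $x$, and $w(q)=\sum_{x\in\mathrm{free}(Q)}w_x(q(x))$. A functional dependency (FD) $R:\mathbf X\to y$, where $\mathbf X\cup\{y\}$ is contained in the variables of the atom of $Q$ with symbol $R$, is satisfied by $I$ if any two tuples of $R^I$ that agree on $\mathbf X$ agree on $y$; it is unary if $|\mathbf X|=1$. The FD-extension $(Q^+,\Delta^+)$ of a self-join-free CQ $Q$ with FDs $\Delta$ is obtained by applying the following steps until none applies, for FDs $R:\mathbf X\to y$ of the current FD set: (1) if an atom $S(\mathbf Z)$ has $\mathbf X\subseteq\mathbf Z$ and $y\notin\mathbf Z$, replace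 it by $S(\mathbf Z,y)$ (increasing the arity of $S$) and add the FD $S:\mathbf X\to y$; (2) if $\mathbf X\subseteq\mathrm{free}(Q)$ and $y\notin\mathrm{free}(Q)$, add $y$ to $\mathrm{free}(Q)$. A weight-preserving exact reduction from a CQ $Q_1$ with FDs $\Delta_1$ to a CQ $Q_2$ with FDs $\Delta_2$ consists of two programs for a random access machine with uniform cost, such that for every database $I$ over the schema of $Q_1$ that satisfies $\Delta_1$: the first program constructs in time $O(|I|+1)$ a database $I'$ over the schema of $Q_2$ that satisfies $\Delta_2$; there is a bijection $\tau$ from $Q_2(I')$ to $Q_1(I)$ that the second program, with access to the arrays left by the first, computes in time $O(1)$ per answer; and for every weight function $w$ for $Q_1$ there is a weight function $w'$ for $Q_2$ with $w(\tau(q'))=w'(q')$ for all $q'\in Q_2(I')$. The programs and the constants in the time bounds depend only on $Q_1,\Delta_1,Q_2,\Delta_2$. Theorem. Let $Q$ be a self-join-free CQ with a set $\Delta$ of unary FDs, and let $Q^+$ be its FD-extension. There is a weight-preserving exact reduction from $Q$ with $\Delta$ to $Q^+$ without FDs, and there is a weight-preserving exact reduction from $Q^+$ without FDs to $Q$ with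 $\Delta$. -/

import Mathlib

/-! ## Conjunctive queries and databases

Relation symbols, variables and constants of the domain are all named by natural numbers.
-/

/-- An atom `R(X₁, …, X_k)`: a relation symbol and a tuple of variables (repetitions allowed). -/
structure Atom where
  rel : ℕ
  args : List ℕ

/-- The set of variables of an atom. -/
def Atom.vars (a : Atom) : Finset ℕ := a.args.toFinset

/-- A conjunctive query `Q(free) :- atoms`. -/
structure CQ where
  atoms : List Atom
  free : Finset ℕ

namespace CQ

/-- Every free variable appears in some atom. -/
def Safe (Q : CQ) : Prop := ∀ x ∈ Q.free, ∃ a ∈ Q.atoms, x ∈ a.vars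

/-- No relation symbol is repeated. -/
def SelfJoinFree (Q : CQ) : Prop := (Q.atoms.map Atom.rel).Nodup

/-- The relation symbols of the query (its schema). -/
def rels (Q : CQ) : Finset ℕ := (Q.atoms.map Atom.rel).toFinset

end CQ

/-- A database instance: a finite relation for every relation symbol. -/
abbrev Database := ℕ → Finset (List ℕ)

/-- `I` is a database over the schema of `Q`: only symbols of `Q` have tuples, and these have the
arity that `Q` gives to the symbol. -/
def Database.Over (I : Database) (Q : CQ) : Prop :=
  ∀ R, ∀ t ∈ I R, ∃ a ∈ Q.atoms, a.rel = R ∧ t.length = a.args.length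

/-- The size of a database over the schema of `Q`: its total number of tuples. -/
def Database.size (I : Database) (Q : CQ) : ℕ := ∑ R ∈ Q.rels, (I R).card

/-- A possible query answer: an assignment of constants to the free variables. -/
abbrev CQ.Answer (Q : CQ) := Q.free → ℕ

/-- `h` maps every atom of `Q` to a tuple of `I`. -/
def CQ.IsHom (Q : CQ) (I : Database) (h : ℕ → ℕ) : Prop :=
  ∀ a ∈ Q.atoms, a.args.map h ∈ I a.rel

/-- `Q(I)`: the homomorphisms from `Q` to `I`, projected on the free variables. -/
def CQ.answers (Q : CQ) (I : Database) : Set Q.Answer :=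
  {q | ∃ h : ℕ → ℕ, Q.IsHom I h ∧ ∀ x : Q.free, q x = h x}

/-- A weight function: a real weight for every domain value of every variable. -/
abbrev WeightFn := ℕ → ℕ → ℝ

/-- The weight of an answer: the sum of the weights of the values of the free variables. -/
noncomputable def CQ.weight (Q : CQ) (w : WeightFn) (q : Q.Answer) : ℝ :=
  ∑ x : Q.free, w x (q x)

/-! ## Functional dependencies -/

/-- A functional dependency `R : X → y`, written with query variables. -/
structure FD where
  rel : ℕ
  lhs : Finset ℕ
  rhs : ℕ
deriving DecidableEq

/-- The variables of the dependency are variables of an atom of `Q` with its relation symbol. -/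
def FD.On (φ : FD) (Q : CQ) : Prop :=
  ∃ a ∈ Q.atoms, a.rel = φ.rel ∧ φ.lhs ⊆ a.vars ∧ φ.rhs ∈ a.vars

/-- The left-hand side is a single variable. -/
def FD.Unary (φ : FD) : Prop := φ.lhs.card = 1

/-- `t[x] = c`: the tuple `t`, read along the atom `a`, has the value `c` at every position of the
variable `x`. -/
def Atom.Assigns (a : Atom) (t : List ℕ) (x c : ℕ) : Prop :=
  ∀ p ∈ a.args.zip t, p.1 = x → p.2 = c

/-- Any two tuples of the relation that agree on `X` agree on `y`. -/
def FD.Holds (φ : FD) (Q : CQ) (I : Database) : Prop :=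
  ∀ a ∈ Q.atoms, a.rel = φ.rel → ∀ t₁ ∈ I φ.rel, ∀ t₂ ∈ I φ.rel,
    (∀ x ∈ φ.lhs, ∃ c, a.Assigns t₁ x c ∧ a.Assigns t₂ x c) →
      ∀ d₁ d₂, a.Assigns t₁ φ.rhs d₁ → a.Assigns t₂ φ.rhs d₂ → d₁ = d₂

/-- `I` satisfies all dependencies of `Δ`. -/
def Database.Satisfies (I : Database) (Q : CQ) (Δ : Finset FD) : Prop := ∀ φ ∈ Δ, φ.Holds Q I

/-- The two kinds of extension step, for a dependency `R : X → y` of the current set: append `y`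
to an atom that contains `X` but not `y` and record the dependency there; make `y` free if all of
`X` is free and `y` is not. -/
inductive ExtStep : CQ × Finset FD → CQ × Finset FD → Prop
  | atom {l₁ l₂ : List Atom} {a : Atom} {free : Finset ℕ} {Δ : Finset FD} {φ : FD}
      (hφ : φ ∈ Δ) (hX : φ.lhs ⊆ a.vars) (hy : φ.rhs ∉ a.vars) :
      ExtStep (⟨l₁ ++ a :: l₂, free⟩, Δ)
        (⟨l₁ ++ ⟨a.rel, a.args ++ [φ.rhs]⟩ :: l₂, free⟩, insert ⟨a.rel, φ.lhs, φ.rhs⟩ Δ)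
  | free {atoms : List Atom} {free : Finset ℕ} {Δ : Finset FD} {φ : FD}
      (hφ : φ ∈ Δ) (hX : φ.lhs ⊆ free) (hy : φ.rhs ∉ free) :
      ExtStep (⟨atoms, free⟩, Δ) (⟨atoms, insert φ.rhs free⟩, Δ)

/-- `(Q', Δ')` is the FD-extension of `(Q, Δ)`: it is obtained by extension steps, and no further
step applies. (It is unique up to the order of the columns that are appended to an atom.) -/
def IsFDExtension (Q : CQ) (Δ : Finset FD) (Q' : CQ) (Δ' : Finset FD) : Prop :=
  Relation.ReflTransGen ExtStep (Q, Δ) (Q', Δ') ∧ ∀ p, ¬ ExtStep (Q', Δ') p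

/-- Extension steps terminate, so that the FD-extension exists. -/
theorem exists_isFDExtension (Q : CQ) (Δ : Finset FD) : ∃ Q' Δ', IsFDExtension Q Δ Q' Δ' := by
  classical
  have key : ∀ (V : Finset ℕ) (n : ℕ) (p : CQ × Finset FD), (∀ φ ∈ p.2, φ.rhs ∈ V) →
      (p.1.atoms.map fun a => (V \ a.vars).card).sum + (V \ p.1.free).card = n →
      ∃ p', Relation.ReflTransGen ExtStep p p' ∧ ∀ r, ¬ ExtStep p' r := by
    intro V n
    induction n using Nat.strong_induction_on with
    | _ n ih =>
      intro p hV hn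
      by_cases hstep : ∃ r, ExtStep p r
      · obtain ⟨r, hr⟩ := hstep
        have hdec : ∀ (y : ℕ) (A : Finset ℕ), y ∈ V → y ∉ A →
            (V \ insert y A).card < (V \ A).card := by
          intro y A hyV hyA
          apply Finset.card_lt_card
          rw [Finset.ssubset_iff_of_subset
            (Finset.sdiff_subset_sdiff (le_refl _) (Finset.subset_insert _ _))]
          exact ⟨y, by simp [hyV, hyA], by simp⟩
        have main : (∀ φ ∈ r.2, φ.rhs ∈ V) ∧
            (r.1.atoms.map fun a => (V \ a.vars).card).sum + (V \ r.1.free).card < n := by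
          cases hr with
          | @atom l₁ l₂ a free Δ φ hφ hX hy =>
            have hv : (⟨a.rel, a.args ++ [φ.rhs]⟩ : Atom).vars = insert φ.rhs a.vars := by
              ext z; simp [Atom.vars]
            have h := hdec φ.rhs a.vars (hV φ hφ) hy
            refine ⟨?_, ?_⟩
            · intro ψ hψ
              rcases Finset.mem_insert.1 hψ with rfl | hψ
              · exact hV φ hφ
              · exact hV ψ hψ
            · subst hn
              simp only [List.map_append, List.map_cons, List.sum_append, List.sum_cons, hv]
              omega
          | @free atoms free Δ φ hφ hX hy =>
            refine ⟨hV, ?_⟩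
            have h := hdec φ.rhs free (hV φ hφ) hy
            subst hn
            simpa using h
        obtain ⟨p', h₁, h₂⟩ := ih _ main.2 r main.1 rfl
        exact ⟨p', Relation.ReflTransGen.head hr h₁, h₂⟩
      · exact ⟨p, Relation.ReflTransGen.refl, fun r hr => hstep ⟨r, hr⟩⟩
  obtain ⟨⟨Q', Δ'⟩, h⟩ := key (Δ.image FD.rhs) _ (Q, Δ)
    (fun φ hφ => Finset.mem_image_of_mem _ hφ) rfl
  exact ⟨Q', Δ', h⟩

/-! ## Random access machine with uniform cost

The words of the machine are natural numbers, of any size. It has registers and arrays, whose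
names are part of the program text; the cells of an array are addressed by computed indices.
Every instruction and every test has cost one. The arithmetic is addition and (truncated)
subtraction only.
-/

namespace RAM

/-- Names of registers and of arrays: for the input database, the output database, the answer to
be translated, the translated answer, and for working memory. -/
inductive Name where
  | inp (R : ℕ)
  | out (R : ℕ)
  | ansIn (x : ℕ)
  | ansOut (x : ℕ)
  | work (k : ℕ)
deriving DecidableEq

structure State where
  reg : Name → ℕ
  mem : Name → ℕ → ℕ

def State.setReg (s : State) (x : Name) (v : ℕ) : State :=
  { s with reg := Function.update s.reg x v }

def State.setMem (s : State) (A : Name) (i v : ℕ) : State :=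
  { s with mem := Function.update s.mem A (Function.update (s.mem A) i v) }

/-- Comparisons of two registers. -/
inductive Test where
  | eq (x y : Name)
  | lt (x y : Name)

def Test.Holds : Test → State → Prop
  | .eq x y, s => s.reg x = s.reg y
  | .lt x y, s => s.reg x < s.reg y

/-- Programs. -/
inductive Prog where
  /-- no operation -/
  | skip
  /-- `x := k` -/
  | const (x : Name) (k : ℕ)
  /-- `x := y` -/
  | move (x y : Name)
  /-- `x := y + z` -/
  | add (x y z : Name)
  /-- `x := y - z` -/
  | sub (x y z : Name)
  /-- `x := A[y]` -/
  | load (x A y : Name)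
  /-- `A[y] := x` -/
  | store (A y x : Name)
  | seq (p q : Prog)
  | cond (b : Test) (p q : Prog)
  | loop (b : Test) (p : Prog)

/-- `Exec p s n s'`: started in state `s`, the program `p` halts in state `s'` after `n` steps. -/
inductive Exec : Prog → State → ℕ → State → Prop
  | skip {s} : Exec .skip s 1 s
  | const {s x k} : Exec (.const x k) s 1 (s.setReg x k)
  | move {s x y} : Exec (.move x y) s 1 (s.setReg x (s.reg y))
  | add {s x y z} : Exec (.add x y z) s 1 (s.setReg x (s.reg y + s.reg z))
  | sub {s x y z} : Exec (.sub x y z) s 1 (s.setReg x (s.reg y - s.reg z))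
  | load {s x A y} : Exec (.load x A y) s 1 (s.setReg x (s.mem A (s.reg y)))
  | store {s A y x} : Exec (.store A y x) s 1 (s.setMem A (s.reg y) (s.reg x))
  | seq {s s' s'' p q m n} (hp : Exec p s m s') (hq : Exec q s' n s'') :
      Exec (.seq p q) s (m + n) s''
  | condTrue {s s' b p q n} (hb : b.Holds s) (hp : Exec p s n s') :
      Exec (.cond b p q) s (n + 1) s'
  | condFalse {s s' b p q n} (hb : ¬ b.Holds s) (hq : Exec q s n s') :
      Exec (.cond b p q) s (n + 1) s'
  | loopTrue {s s' s'' b p m n} (hb : b.Holds s) (hp : Exec p s m s')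
      (hl : Exec (.loop b p) s' n s'') : Exec (.loop b p) s (m + n + 1) s''
  | loopFalse {s b p} (hb : ¬ b.Holds s) : Exec (.loop b p) s 1 s

/-- The lists `L R` enumerate the relations of `I`, without repetitions and in any order. -/
def IsListing (L : ℕ → List (List ℕ)) (I : Database) : Prop :=
  ∀ R, (L R).Nodup ∧ (L R).toFinset = I R

/-- The initial state: for every `R`, register `inp R` holds the number of tuples of `R`, and array
`inp R` holds these tuples, one after the other; everything else is zero. -/
def initState (L : ℕ → List (List ℕ)) : State where
  reg
    | .inp R => (L R).length
    | _ => 0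
  mem
    | .inp R => fun i => (L R).flatten.getD i 0
    | _ => fun _ => 0

/-- The state `s` contains the database `I`, in the same format, in the registers and arrays
`out R`. -/
def Outputs (s : State) (I : Database) : Prop :=
  ∃ L, IsListing L I ∧ ∀ R, s.reg (.out R) = (L R).length ∧
    ∀ i < (L R).flatten.length, s.mem (.out R) i = (L R).flatten.getD i 0

/-- With the arrays in the state `mem`, the program `T` computes the answer `q` from the answer `q'`
within `c` steps and leaves the arrays as they were. The registers `ansIn x` hold the values of
`q'`, the registers `ansOut x` receive those of `q`, and the initial contents of all other registers
are arbitrary. -/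
def ComputesAnswer (T : Prog) (c : ℕ) (mem : Name → ℕ → ℕ) {Q Q' : CQ}
    (q' : Q'.Answer) (q : Q.Answer) : Prop :=
  ∀ s : State, s.mem = mem → (∀ x : Q'.free, s.reg (.ansIn x) = q' x) →
    ∃ n s', Exec T s n s' ∧ n ≤ c ∧ s'.mem = mem ∧ ∀ x : Q.free, s'.reg (.ansOut x) = q x

end RAM

/-- There is a weight-preserving exact reduction from `Q` with dependencies `Δ` to `Q'` with
dependencies `Δ'`. A program `P` constructs from every database `I` that satisfies `Δ`, in time
linear in `|I|`, a database `I'` that satisfies `Δ'`; there is a bijection `τ` from `Q'(I')` to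
`Q(I)` that a program `T` evaluates in constant time, with access to the arrays that `P` has left;
and every weight function for `Q` has a counterpart for `Q'` that gives to each answer `q'` the
weight of `τ q'`. -/
def WeightPreservingExactReduction (Q : CQ) (Δ : Finset FD) (Q' : CQ) (Δ' : Finset FD) : Prop :=
  ∃ (P T : RAM.Prog) (c : ℕ), ∀ I : Database, I.Over Q → I.Satisfies Q Δ →
    ∀ L, RAM.IsListing L I →
      ∃ (I' : Database) (n : ℕ) (s : RAM.State) (τ : Q'.Answer → Q.Answer),
        I'.Over Q' ∧ I'.Satisfies Q' Δ' ∧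
        RAM.Exec P (RAM.initState L) n s ∧ n ≤ c * (I.size Q + 1) ∧ RAM.Outputs s I' ∧
        Set.BijOn τ (Q'.answers I') (Q.answers I) ∧
        (∀ q' ∈ Q'.answers I', RAM.ComputesAnswer T c s.mem q' (τ q')) ∧
        ∀ w : WeightFn, ∃ w' : WeightFn, ∀ q' ∈ Q'.answers I', Q.weight w (τ q') = Q'.weight w' q'

/-!
The FD-extension only appends to an atom, or makes free, variables whose values follow from those of
variables already present. Since the dependencies are unary, this is governed by the relation
`Determines` on variables, and `Presents` records all that is needed of the extension: every atom
grows by a list of variables that are derived one by one, the atoms and the free variables of the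
result are closed under `Determines`, and every free variable of the result is determined by
an original one.

From `Q` with dependencies to the extension (`Presents.reduction_to_ext`): each dependency is
tabulated as a function in an array that is addressed by the constants themselves, and each tuple is
extended by lookups. The homomorphisms stay the same. Restriction of answers to the original free
variables is injective because the dependencies fix the other values, and new free variables get
weight zero.

From the extension to `Q` with dependencies (`Presents.reduction_from_ext`): the value of `x` is
replaced by a code of the values of all variables that `x` determines, which any atom of the
extension that contains `x` contains as well, and the appended columns are dropped. If `x`
determines `y`, then the code of `x` contains all that enters into the code of `y`, so the
dependencies hold. A homomorphism of `Q` to the coded database decodes to one of the extension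
(`Presents.exists_isHom_of_isCoded`): the values that different atoms give to a common variable
agree, as one sees along a chain of dependencies. The weight of an original free variable collects
the weights of the free variables that are decoded from it.

The machine has no multiplication, so a code is a sum of numbers in a mixed radix system. For one
variable after the other, its values receive distinct multiples of the current radix by repeated
addition, and the final count is the radix for the next variable (`Separates.snoc`).
Numbers, and values to be decoded, are looked up in arrays, so that everything takes a constant
number of steps per tuple and per answer.

Programs are verified through the loop rule `RAM.runs_forTuples`, whose invariants speak of the
tuples already treated, and through the frame rule `RAM.Runs.frame`.
-/

namespace RAM

/-! ### Running programs: evaluation, cost and written names -/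

/-- The final state of a loop-free program. Loops are skipped: the function is used for loop-free
programs only. -/
noncomputable def Prog.eval : Prog → State → State
  | .skip, s => s
  | .const x k, s => s.setReg x k
  | .move x y, s => s.setReg x (s.reg y)
  | .add x y z, s => s.setReg x (s.reg y + s.reg z)
  | .sub x y z, s => s.setReg x (s.reg y - s.reg z)
  | .load x A y, s => s.setReg x (s.mem A (s.reg y))
  | .store A y x, s => s.setMem A (s.reg y) (s.reg x)
  | .seq p q, s => q.eval (p.eval s)
  | .cond b p q, s => open Classical in if b.Holds s then p.eval s else q.eval s
  | .loop _ _, s => s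

/-- The program contains no loop. -/
def Prog.LoopFree : Prog → Prop
  | .seq p q => p.LoopFree ∧ q.LoopFree
  | .cond _ p q => p.LoopFree ∧ q.LoopFree
  | .loop _ _ => False
  | _ => True

/-- A bound for the number of steps of a program in which every loop is charged as if it were run
about once. Loop-free programs run within their cost, and a program whose loops (none of them
nested) have fewer than `M` iterations runs within `M` times its cost. -/
def Prog.cost : Prog → ℕ
  | .seq p q => p.cost + q.cost
  | .cond _ p q => p.cost + q.cost + 1
  | .loop _ p => p.cost + 1
  | _ => 1

/-- The registers that occur in a program as targets. -/
def Prog.regs : Prog → Set Name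
  | .const x _ => {x}
  | .move x _ => {x}
  | .add x _ _ => {x}
  | .sub x _ _ => {x}
  | .load x _ _ => {x}
  | .seq p q => p.regs ∪ q.regs
  | .cond _ p q => p.regs ∪ q.regs
  | .loop _ p => p.regs
  | _ => ∅

/-- The arrays that occur in a program as targets. -/
def Prog.arrs : Prog → Set Name
  | .store A _ _ => {A}
  | .seq p q => p.arrs ∪ q.arrs
  | .cond _ p q => p.arrs ∪ q.arrs
  | .loop _ p => p.arrs
  | _ => ∅

attribute [simp] Prog.eval Prog.LoopFree Prog.cost Prog.regs Prog.arrs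

@[simp] theorem State.setReg_mem (s : State) (x : Name) (v : ℕ) : (s.setReg x v).mem = s.mem := rfl

@[simp] theorem State.setMem_reg (s : State) (A : Name) (i v : ℕ) :
    (s.setMem A i v).reg = s.reg := rfl

theorem State.setReg_reg (s : State) (x y : Name) (v : ℕ) :
    (s.setReg x v).reg y = if y = x then v else s.reg y := by
  simp [State.setReg, Function.update_apply]

theorem State.setMem_mem (s : State) (A B : Name) (i j v : ℕ) :
    (s.setMem A i v).mem B j = if B = A ∧ j = i then v else s.mem B j := by
  by_cases h : B = A
  · subst h; simp [State.setMem, Function.update_apply]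
  · simp [State.setMem, h]

theorem State.setMem_mem_of_ne (s : State) {A B : Name} (i v : ℕ) (h : B ≠ A) :
    (s.setMem A i v).mem B = s.mem B := by
  simp [State.setMem, h]

theorem exec_eval (p : Prog) (s : State) (hp : p.LoopFree) :
    ∃ n, Exec p s n (p.eval s) ∧ n ≤ p.cost := by
  induction p generalizing s with
  | skip => exact ⟨1, .skip, le_rfl⟩
  | const => exact ⟨1, .const, le_rfl⟩
  | move => exact ⟨1, .move, le_rfl⟩
  | add => exact ⟨1, .add, le_rfl⟩
  | sub => exact ⟨1, .sub, le_rfl⟩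
  | load => exact ⟨1, .load, le_rfl⟩
  | store => exact ⟨1, .store, le_rfl⟩
  | seq p q ihp ihq =>
    obtain ⟨m, h₁, hm⟩ := ihp s hp.1
    obtain ⟨n, h₂, hn⟩ := ihq (p.eval s) hp.2
    exact ⟨m + n, .seq h₁ h₂, by simp only [Prog.cost]; omega⟩
  | cond b p q ihp ihq =>
    by_cases hb : b.Holds s
    · obtain ⟨m, h₁, hm⟩ := ihp s hp.1
      exact ⟨m + 1, by simpa [hb] using Exec.condTrue hb h₁, by simp only [Prog.cost]; omega⟩
    · obtain ⟨m, h₁, hm⟩ := ihq s hp.2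
      exact ⟨m + 1, by simpa [hb] using Exec.condFalse hb h₁, by simp only [Prog.cost]; omega⟩
  | loop => exact hp.elim

theorem Exec.reg_eq {p : Prog} {s s' : State} {n : ℕ} (h : Exec p s n s') {x : Name}
    (hx : x ∉ p.regs) : s'.reg x = s.reg x := by
  induction h with
  | seq _ _ ih₁ ih₂ =>
    simp only [Prog.regs, Set.mem_union, not_or] at hx
    rw [ih₂ hx.2, ih₁ hx.1]
  | condTrue _ _ ih => exact ih fun h => hx (Or.inl h)
  | condFalse _ _ ih => exact ih fun h => hx (Or.inr h)
  | loopTrue _ _ _ ih₁ ih₂ => rw [ih₂ hx, ih₁ hx]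
  | _ => simp_all [State.setReg_reg]

theorem Exec.mem_eq {p : Prog} {s s' : State} {n : ℕ} (h : Exec p s n s') {A : Name}
    (hA : A ∉ p.arrs) : s'.mem A = s.mem A := by
  induction h with
  | seq _ _ ih₁ ih₂ =>
    simp only [Prog.arrs, Set.mem_union, not_or] at hA
    rw [ih₂ hA.2, ih₁ hA.1]
  | condTrue _ _ ih => exact ih fun h => hA (Or.inl h)
  | condFalse _ _ ih => exact ih fun h => hA (Or.inr h)
  | loopTrue _ _ _ ih₁ ih₂ => rw [ih₂ hA, ih₁ hA]
  | store => exact State.setMem_mem_of_ne _ _ _ (by simpa using hA)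
  | _ => rfl

theorem eval_reg_eq {p : Prog} (hp : p.LoopFree) (s : State) {x : Name} (hx : x ∉ p.regs) :
    (p.eval s).reg x = s.reg x := by
  obtain ⟨n, h, -⟩ := exec_eval p s hp
  exact h.reg_eq hx

theorem eval_mem_eq {p : Prog} (hp : p.LoopFree) (s : State) {A : Name} (hA : A ∉ p.arrs) :
    (p.eval s).mem A = s.mem A := by
  obtain ⟨n, h, -⟩ := exec_eval p s hp
  exact h.mem_eq hA

/-- Started in `s`, the program `p` halts within `p.cost * M` steps in a state with the property
`Post`. -/
def Runs (M : ℕ) (p : Prog) (s : State) (Post : State → Prop) : Prop :=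
  ∃ n s', Exec p s n s' ∧ n ≤ p.cost * M ∧ Post s'

theorem Runs.seq {M : ℕ} {p q : Prog} {s : State} {P R : State → Prop} (hp : Runs M p s P)
    (hq : ∀ s', P s' → Runs M q s' R) : Runs M (.seq p q) s R := by
  obtain ⟨m, s₁, h₁, hm, hP⟩ := hp
  obtain ⟨n, s₂, h₂, hn, hR⟩ := hq s₁ hP
  exact ⟨m + n, s₂, .seq h₁ h₂, by simp only [Prog.cost, add_mul]; omega, hR⟩

theorem Runs.mono {M : ℕ} {p : Prog} {s : State} {P R : State → Prop} (hp : Runs M p s P)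
    (h : ∀ s', P s' → R s') : Runs M p s R := by
  obtain ⟨n, s', h₁, h₂, h₃⟩ := hp
  exact ⟨n, s', h₁, h₂, h s' h₃⟩

/-- The frame rule: what a program does not write, it does not change. -/
theorem Runs.frame {M : ℕ} {p : Prog} {s : State} {P : State → Prop} (hp : Runs M p s P) :
    Runs M p s fun s' => P s' ∧ (∀ x ∉ p.regs, s'.reg x = s.reg x) ∧
      ∀ A ∉ p.arrs, s'.mem A = s.mem A := by
  obtain ⟨n, s', h₁, h₂, h₃⟩ := hp
  exact ⟨n, s', h₁, h₂, h₃, fun _ => h₁.reg_eq, fun _ => h₁.mem_eq⟩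

theorem runs_eval {M : ℕ} (hM : 1 ≤ M) {p : Prog} (hp : p.LoopFree) {s : State}
    {P : State → Prop} (h : P (p.eval s)) : Runs M p s P := by
  obtain ⟨n, h₁, h₂⟩ := exec_eval p s hp
  exact ⟨n, _, h₁, h₂.trans (Nat.le_mul_of_pos_right _ hM), h⟩

/-- Sequential composition of a list of programs. -/
def seqs : List Prog → Prog
  | [] => .skip
  | p :: ps => .seq p (seqs ps)

@[simp] theorem seqs_nil : seqs [] = .skip := rfl

@[simp] theorem seqs_cons (p : Prog) (ps : List Prog) : seqs (p :: ps) = .seq p (seqs ps) := rfl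

@[simp] theorem loopFree_seqs {ps : List Prog} : (seqs ps).LoopFree ↔ ∀ p ∈ ps, p.LoopFree := by
  induction ps with
  | nil => simp
  | cons p ps ih => simp [ih]

@[simp] theorem mem_regs_seqs {ps : List Prog} {x : Name} :
    x ∈ (seqs ps).regs ↔ ∃ p ∈ ps, x ∈ p.regs := by
  induction ps with
  | nil => simp
  | cons p ps ih => simp [ih]

@[simp] theorem mem_arrs_seqs {ps : List Prog} {A : Name} :
    A ∈ (seqs ps).arrs ↔ ∃ p ∈ ps, A ∈ p.arrs := by
  induction ps with
  | nil => simp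
  | cons p ps ih => simp [ih]

/-- To run a list of programs, maintain an invariant that speaks of the part already run. -/
theorem runs_seqs {ι : Type*} {M : ℕ} (hM : 1 ≤ M) (f : ι → Prog) (l : List ι)
    (Inv : List ι → State → Prop) (s : State) (h₀ : Inv [] s)
    (hstep : ∀ d i r s, l = d ++ i :: r → Inv d s → Runs M (f i) s (Inv (d ++ [i]))) :
    Runs M (seqs (l.map f)) s (Inv l) := by
  suffices H : ∀ r d s, l = d ++ r → Inv d s → Runs M (seqs (r.map f)) s (Inv l) from
    H l [] s rfl h₀
  intro r
  induction r with
  | nil =>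
    intro d s hl hd
    rw [List.append_nil] at hl
    subst hl
    exact runs_eval hM (by simp) (by simpa using hd)
  | cons i r ih =>
    intro d s hl hd
    exact (hstep d i r s hl hd).seq fun s' hs' => ih (d ++ [i]) s' (by simp [hl]) hs'

/-! ### Iterating over the tuples of a relation -/

/-- The register for the value of the variable `v` in the current tuple. -/
abbrev val (v : ℕ) : Name := .work (Nat.pair 0 v)

/-- A register for intermediate values. -/
abbrev tmp : Name := .work (Nat.pair 1 0)

/-- The register that holds the number one. -/
abbrev one : Name := .work (Nat.pair 1 1)

/-- The number of tuples already treated. -/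
abbrev idx : Name := .work (Nat.pair 1 2)

/-- The read position in an input array. -/
abbrev ptr : Name := .work (Nat.pair 1 3)

/-- The read position of the second pass over a tuple, which tests its consistency. -/
abbrev chk : Name := .work (Nat.pair 1 4)

/-- The write position in an output array. -/
abbrev optr : Name := .work (Nat.pair 1 5)

/-- The array `A` holds the list, from the cell `b` on. -/
def Stores (A : ℕ → ℕ) : ℕ → List ℕ → Prop
  | _, [] => True
  | b, c :: l => A b = c ∧ Stores A (b + 1) l

theorem stores_append {A : ℕ → ℕ} {b : ℕ} {l₁ l₂ : List ℕ} :
    Stores A b (l₁ ++ l₂) ↔ Stores A b l₁ ∧ Stores A (b + l₁.length) l₂ := by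
  induction l₁ generalizing b with
  | nil => simp [Stores]
  | cons c l₁ ih => simp [Stores, ih, and_assoc, Nat.add_assoc, Nat.add_comm 1]

theorem stores_iff {A : ℕ → ℕ} {b : ℕ} {l : List ℕ} :
    Stores A b l ↔ ∀ i < l.length, A (b + i) = l.getD i 0 := by
  induction l generalizing b with
  | nil => simp [Stores]
  | cons c l ih =>
    simp only [Stores, ih, List.length_cons]
    constructor
    · rintro ⟨h, h'⟩ (_ | i) hi
      · simpa using h
      · simpa [Nat.add_assoc, Nat.add_comm 1] using h' i (by omega)
    · intro h
      refine ⟨by simpa using h 0 (by omega), fun i hi => ?_⟩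
      simpa [Nat.add_assoc, Nat.add_comm 1] using h (i + 1) (by omega)

theorem Stores.congr {A B : ℕ → ℕ} {b : ℕ} {l : List ℕ} (h : Stores A b l)
    (hAB : ∀ i < b + l.length, B i = A i) : Stores B b l := by
  rw [stores_iff] at h ⊢
  intro i hi
  rw [hAB _ (by omega), h i hi]

/-- The value of the variable `v` in the tuple `t`, taken from the first position of `v`. -/
def read (args t : List ℕ) (v : ℕ) : ℕ := t.getD (args.idxOf v) 0

/-- The tuple is consistent: repeated variables have equal values. -/
def Fits (args t : List ℕ) : Prop := args.map (read args t) = t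

instance (args t : List ℕ) : Decidable (Fits args t) :=
  inferInstanceAs (Decidable (args.map (read args t) = t))

theorem read_map {args : List ℕ} (h : ℕ → ℕ) {v : ℕ} (hv : v ∈ args) :
    read args (args.map h) v = h v := by
  have := List.idxOf_lt_length_of_mem hv
  simp [read, List.getD_eq_getElem?_getD, this]

theorem fits_map (args : List ℕ) (h : ℕ → ℕ) : Fits args (args.map h) :=
  List.map_congr_left fun _ hv => read_map h hv

/-- Copy the next tuple of `R` to the registers of its variables. -/
def loadTuple (R : ℕ) : List ℕ → Prog
  | [] => .skip
  | v :: vs => .seq (.load (val v) (.inp R) ptr) (.seq (.add ptr ptr one) (loadTuple R vs))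

/-- Run `p` if the tuple agrees with the registers of its variables at every position. -/
def guardTuple (R : ℕ) (p : Prog) : List ℕ → Prog
  | [] => p
  | v :: vs => .seq (.load tmp (.inp R) chk) (.seq (.add chk chk one)
      (.cond (.eq tmp (val v)) (guardTuple R p vs) .skip))

/-- One iteration of `forTuples`: the first pass over the tuple fills the registers, the second one
tests whether they agree with every position. -/
def tupleStep (R : ℕ) (args : List ℕ) (p : Prog) : Prog :=
  .seq (.move chk ptr) (.seq (loadTuple R args) (.seq (guardTuple R p args) (.add idx idx one)))

/-- Run `p` for every consistent tuple of `R`, with the values of the variables in registers. -/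
def forTuples (R : ℕ) (args : List ℕ) (p : Prog) : Prog :=
  .seq (.const one 1) (.seq (.const idx 0) (.seq (.const ptr 0)
    (.loop (.lt idx (.inp R)) (tupleStep R args p))))

/-- The registers used by `forTuples` itself. -/
def loopRegs : Set Name := {one, idx, ptr, chk, tmp} ∪ Set.range val

theorem loopFree_loadTuple (R : ℕ) (args : List ℕ) : (loadTuple R args).LoopFree := by
  induction args with
  | nil => simp [loadTuple]
  | cons v vs ih => simp [loadTuple, ih]

theorem loopFree_guardTuple (R : ℕ) {p : Prog} (hp : p.LoopFree) (args : List ℕ) :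
    (guardTuple R p args).LoopFree := by
  induction args with
  | nil => simpa [guardTuple]
  | cons v vs ih => simp [guardTuple, ih]

theorem regs_loadTuple (R : ℕ) (args : List ℕ) :
    (loadTuple R args).regs ⊆ {ptr} ∪ Set.range val := by
  induction args with
  | nil => simp [loadTuple]
  | cons v vs ih =>
    simp only [loadTuple, Prog.regs, Set.union_subset_iff]
    exact ⟨by simp, by simp, ih⟩

theorem regs_guardTuple (R : ℕ) (p : Prog) (args : List ℕ) :
    (guardTuple R p args).regs ⊆ p.regs ∪ {tmp, chk} := by
  induction args with
  | nil => exact Set.subset_union_left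
  | cons v vs ih =>
    simp only [guardTuple, Prog.regs, Set.union_subset_iff]
    exact ⟨by simp, by simp, ih, by simp⟩

theorem arrs_loadTuple (R : ℕ) (args : List ℕ) : (loadTuple R args).arrs = ∅ := by
  induction args with
  | nil => simp [loadTuple]
  | cons v vs ih => simp [loadTuple, ih]

theorem arrs_guardTuple (R : ℕ) (p : Prog) (args : List ℕ) :
    (guardTuple R p args).arrs ⊆ p.arrs := by
  induction args with
  | nil => simp [guardTuple]
  | cons v vs ih => simpa [guardTuple] using ih

theorem regs_forTuples (R : ℕ) (args : List ℕ) (p : Prog) :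
    (forTuples R args p).regs ⊆ p.regs ∪ loopRegs := by
  have h₁ := regs_loadTuple R args
  have h₂ := regs_guardTuple R p args
  intro x hx
  have h₁ := @h₁ x
  have h₂ := @h₂ x
  simp only [forTuples, tupleStep, Prog.regs, loopRegs, Set.mem_union, Set.mem_insert_iff,
    Set.mem_singleton_iff] at *
  tauto

theorem arrs_forTuples (R : ℕ) (args : List ℕ) (p : Prog) :
    (forTuples R args p).arrs ⊆ p.arrs := by
  simpa [forTuples, tupleStep, arrs_loadTuple] using arrs_guardTuple R p args

theorem ptr_eval_loadTuple (R : ℕ) (args : List ℕ) (s : State) (hone : s.reg one = 1) :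
    ((loadTuple R args).eval s).reg ptr = s.reg ptr + args.length := by
  induction args generalizing s with
  | nil => simp [loadTuple]
  | cons v vs ih =>
    simp only [loadTuple, Prog.eval]
    rw [ih _ (by simp [State.setReg_reg, hone])]
    simp [State.setReg_reg, hone]
    omega

theorem val_eval_loadTuple (R : ℕ) (args : List ℕ) (s : State) (hone : s.reg one = 1)
    (h : ℕ → ℕ) (hst : Stores (s.mem (.inp R)) (s.reg ptr) (args.map h)) (v : ℕ)
    (hv : s.reg (val v) = h v ∨ v ∈ args) : ((loadTuple R args).eval s).reg (val v) = h v := by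
  induction args generalizing s with
  | nil => simpa [loadTuple] using hv
  | cons w vs ih =>
    simp only [loadTuple, Prog.eval]
    simp only [List.map_cons, Stores] at hst
    refine ih _ (by simp [State.setReg_reg, hone]) ?_ ?_
    · simpa [State.setReg_reg, hone] using hst.2
    · by_cases hvw : v = w
      · simp [State.setReg_reg, hvw, hst.1]
      · simpa [State.setReg_reg, hvw] using hv

/-- The guard recognizes the tuples that agree with the registers of the variables. -/
theorem eval_guardTuple (R : ℕ) (p : Prog) (args t : List ℕ) (s : State) (hone : s.reg one = 1)
    (hst : Stores (s.mem (.inp R)) (s.reg chk) t) (hlen : t.length = args.length) :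
    ∃ s', s'.mem = s.mem ∧ (∀ x, x ≠ tmp → x ≠ chk → s'.reg x = s.reg x) ∧
      (args.map (fun v => s.reg (val v)) = t ∧ (guardTuple R p args).eval s = p.eval s' ∨
        args.map (fun v => s.reg (val v)) ≠ t ∧ (guardTuple R p args).eval s = s') := by
  induction args generalizing s t with
  | nil =>
    obtain rfl : t = [] := by simpa using hlen
    exact ⟨s, rfl, fun _ _ _ => rfl, Or.inl ⟨rfl, rfl⟩⟩
  | cons v vs ih =>
    obtain _ | ⟨c, t⟩ := t
    · simp at hlen
    simp only [Stores] at hst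
    set s₁ := s.setReg tmp (s.mem (.inp R) (s.reg chk)) with hs₁
    set s₂ := s₁.setReg chk (s₁.reg chk + s₁.reg one) with hs₂
    have hr : ∀ x, x ≠ tmp → x ≠ chk → s₂.reg x = s.reg x := by
      intro x h₁ h₂
      simp [hs₂, hs₁, State.setReg_reg, h₁, h₂]
    have htmp : s₂.reg tmp = c := by simp [hs₂, hs₁, State.setReg_reg, hst.1]
    have hchk : s₂.reg chk = s.reg chk + 1 := by simp [hs₂, hs₁, State.setReg_reg, hone]
    have hval : ∀ w, s₂.reg (val w) = s.reg (val w) := fun w => hr _ (by simp) (by simp)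
    by_cases hc : (Test.eq tmp (val v)).Holds s₂
    · have he : (guardTuple R p (v :: vs)).eval s = (guardTuple R p vs).eval s₂ := if_pos hc
      rw [he]
      have hc' : s.reg (val v) = c := by
        simp only [Test.Holds, htmp, hval] at hc
        exact hc.symm
      obtain ⟨s', h₁, h₂, h₃⟩ := ih t s₂ (by rw [hr _ (by simp) (by simp), hone])
        (by rw [hchk]; exact hst.2) (by simpa using hlen)
      refine ⟨s', h₁, fun x hx hx' => (h₂ x hx hx').trans (hr x hx hx'), ?_⟩
      simpa [hval, hc'] using h₃
    · have he : (guardTuple R p (v :: vs)).eval s = s₂ := if_neg hc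
      rw [he]
      refine ⟨s₂, rfl, hr, Or.inr ⟨?_, rfl⟩⟩
      intro h
      simp only [List.map_cons, List.cons.injEq] at h
      exact hc (by simp only [Test.Holds, htmp, hval, h.1])

/-- The loop rule for `forTuples`: an invariant, which speaks of the tuples already treated and
does not depend on the auxiliary registers of the loop, holds at the end if inconsistent tuples can
be ignored and if `p` maintains it for every consistent tuple. -/
theorem runs_forTuples {M R : ℕ} {args : List ℕ} {p : Prog} {L : List (List ℕ)} {s₀ : State}
    (hp : p.LoopFree) (hreg : ∀ x ∈ ({one, idx, ptr, Name.inp R} : Set Name), x ∉ p.regs)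
    (harr : Name.inp R ∉ p.arrs) (hn : s₀.reg (.inp R) = L.length)
    (hst : Stores (s₀.mem (.inp R)) 0 L.flatten) (hlen : ∀ t ∈ L, t.length = args.length)
    (hM : L.length + 1 ≤ M) (Inv : List (List ℕ) → State → Prop)
    (hcongr : ∀ d s s', Inv d s → s'.mem = s.mem → (∀ x ∉ loopRegs, s'.reg x = s.reg x) →
      Inv d s')
    (h₀ : Inv [] s₀)
    (hskip : ∀ d t s, ¬ Fits args t → Inv d s → Inv (d ++ [t]) s)
    (hstep : ∀ d t r s, L = d ++ t :: r → Fits args t → Inv d s →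
      (∀ v ∈ args, s.reg (val v) = read args t v) → s.reg one = 1 →
      (∀ A ∉ p.arrs, s.mem A = s₀.mem A) →
      (∀ x ∉ p.regs ∪ loopRegs, s.reg x = s₀.reg x) → Inv (d ++ [t]) (p.eval s)) :
    Runs M (forTuples R args p) s₀ (Inv L) := by
  have hfree : (tupleStep R args p).LoopFree := by
    simp [tupleStep, loopFree_loadTuple, loopFree_guardTuple R hp]
  have hpone := hreg one (by simp)
  have hpidx := hreg idx (by simp)
  have hpptr := hreg ptr (by simp)
  have hpinp := hreg (.inp R) (by simp)
  -- One iteration.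
  have step : ∀ d t r s, L = d ++ t :: r → Inv d s → s.reg one = 1 →
      s.reg ptr = d.flatten.length → (∀ A ∉ p.arrs, s.mem A = s₀.mem A) →
      (∀ x ∉ p.regs ∪ loopRegs, s.reg x = s₀.reg x) →
      Inv (d ++ [t]) ((tupleStep R args p).eval s) ∧
        ((tupleStep R args p).eval s).reg one = 1 ∧
        ((tupleStep R args p).eval s).reg ptr = (d ++ [t]).flatten.length ∧
        ((tupleStep R args p).eval s).reg idx = s.reg idx + 1 := by
    intro d t r s hL hInv hone hptr hmem hregs
    have htlen : t.length = args.length := hlen t (by simp [hL])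
    have hstt : Stores (s.mem (.inp R)) (s.reg ptr) t := by
      rw [hmem _ harr, hptr]
      rw [hL, List.flatten_append, List.flatten_cons, stores_append, stores_append] at hst
      simpa using hst.2.1
    simp only [tupleStep, Prog.eval]
    set s₁ := s.setReg chk (s.reg ptr) with hs₁
    have hone₁ : s₁.reg one = 1 := by simp [hs₁, State.setReg_reg, hone]
    set s₂ := (loadTuple R args).eval s₁ with hs₂
    have hfree₂ := loopFree_loadTuple R args
    have hmem₂ : s₂.mem = s.mem := by
      funext A
      rw [hs₂, eval_mem_eq hfree₂ _ (by simp [arrs_loadTuple])]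
      rfl
    have hreg₂ : ∀ x, x ≠ chk → x ≠ ptr → x ∉ Set.range val → s₂.reg x = s.reg x := by
      intro x h₁ h₂ h₃
      rw [hs₂, eval_reg_eq hfree₂ _ (fun h => by
        rcases regs_loadTuple R args h with h | h
        · exact h₂ h
        · exact h₃ h)]
      simp [hs₁, State.setReg_reg, h₁]
    have hptr₂ : s₂.reg ptr = s.reg ptr + args.length := by
      rw [hs₂, ptr_eval_loadTuple R args s₁ hone₁]
      simp [hs₁, State.setReg_reg]
    have hchk₂ : s₂.reg chk = s.reg ptr := by
      rw [hs₂, eval_reg_eq hfree₂ _ (fun h => by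
        rcases regs_loadTuple R args h with h | ⟨v, h⟩ <;> simp at h)]
      simp [hs₁, State.setReg_reg]
    have hval₂ : Fits args t → ∀ v ∈ args, s₂.reg (val v) = read args t v := by
      intro hf v hv
      refine val_eval_loadTuple R args s₁ hone₁ _ ?_ v (Or.inr hv)
      rw [hf]
      simpa [hs₁, State.setReg_reg] using hstt
    have hone₂ : s₂.reg one = 1 := by rw [hreg₂ _ (by simp) (by simp) (by simp), hone]
    obtain ⟨s₃, hmem₃, hreg₃, hcase⟩ := eval_guardTuple R p args t s₂ hone₂
      (by rw [hchk₂, hmem₂]; exact hstt) htlen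
    have hloop : ∀ x ∉ loopRegs, s₃.reg x = s.reg x := by
      intro x hx
      simp only [loopRegs, Set.mem_union, Set.mem_insert_iff, Set.mem_singleton_iff, not_or] at hx
      rw [hreg₃ x hx.1.2.2.2.2 hx.1.2.2.2.1, hreg₂ x hx.1.2.2.2.1 hx.1.2.2.1 hx.2]
    have hone₃ : s₃.reg one = 1 := by rw [hreg₃ _ (by simp) (by simp), hone₂]
    have hptr₃ : s₃.reg ptr = (d ++ [t]).flatten.length := by
      rw [hreg₃ _ (by simp) (by simp), hptr₂, hptr]
      simp [htlen]
    have hidx₃ : s₃.reg idx = s.reg idx := by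
      rw [hreg₃ _ (by simp) (by simp), hreg₂ _ (by simp) (by simp) (by simp)]
    have hInv₃ : Inv d s₃ := hcongr d s s₃ hInv (hmem₃.trans hmem₂) hloop
    have key : ∃ s₄, (guardTuple R p args).eval s₂ = s₄ ∧ Inv (d ++ [t]) s₄ ∧ s₄.reg one = 1 ∧
        s₄.reg ptr = (d ++ [t]).flatten.length ∧ s₄.reg idx = s.reg idx := by
      refine ⟨_, rfl, ?_⟩
      rcases hcase with ⟨ht, he⟩ | ⟨ht, he⟩
      · have hf : Fits args t := by rw [← ht]; exact fits_map _ _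
        rw [he, eval_reg_eq hp _ hpone, eval_reg_eq hp _ hpptr, eval_reg_eq hp _ hpidx]
        refine ⟨hstep d t r s₃ hL hf hInv₃ ?_ hone₃ ?_ ?_, hone₃, hptr₃, hidx₃⟩
        · intro v hv
          rw [hreg₃ _ (by simp) (by simp), hval₂ hf v hv]
        · intro A hA
          rw [hmem₃, hmem₂, hmem A hA]
        · intro x hx
          rw [hloop x (fun h => hx (Or.inr h)), hregs x hx]
      · have hf : ¬ Fits args t := fun hf => ht (by
          rw [List.map_congr_left (hval₂ hf)]
          exact hf)
        rw [he]
        exact ⟨hskip d t s₃ hf hInv₃, hone₃, hptr₃, hidx₃⟩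
    obtain ⟨s₄, he, h₁, h₂, h₃, h₄⟩ := key
    rw [he]
    refine ⟨hcongr _ _ _ h₁ rfl ?_, ?_, ?_, ?_⟩
    · intro x hx
      have : x ≠ idx := by rintro rfl; exact hx (by simp [loopRegs])
      simp [State.setReg_reg, this]
    · simp [State.setReg_reg, h₂]
    · simpa [State.setReg_reg] using h₃
    · simp [State.setReg_reg, h₂, h₄]
  have hframe_reg : ∀ s x, x ∉ p.regs ∪ loopRegs →
      ((tupleStep R args p).eval s).reg x = s.reg x := by
    intro s x hx
    refine eval_reg_eq hfree s fun h => hx (regs_forTuples R args p ?_)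
    simp only [forTuples, Prog.regs, Set.mem_union]
    tauto
  have hframe_mem : ∀ s A, A ∉ p.arrs → ((tupleStep R args p).eval s).mem A = s.mem A := by
    intro s A hA
    refine eval_mem_eq hfree s fun h => hA (arrs_forTuples R args p ?_)
    simp only [forTuples, Prog.arrs, Set.mem_union]
    tauto
  have hinp : Name.inp R ∉ p.regs ∪ loopRegs := by
    simp [loopRegs, hpinp]
  -- The loop, started when the tuples `d` have been treated and the tuples `r` remain.
  have loop : ∀ r d s, L = d ++ r → Inv d s → s.reg one = 1 → s.reg idx = d.length →
      s.reg ptr = d.flatten.length → (∀ A ∉ p.arrs, s.mem A = s₀.mem A) →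
      (∀ x ∉ p.regs ∪ loopRegs, s.reg x = s₀.reg x) →
      ∃ n s', Exec (.loop (.lt idx (.inp R)) (tupleStep R args p)) s n s' ∧
        n ≤ ((tupleStep R args p).cost + 1) * r.length + 1 ∧ Inv L s' := by
    intro r
    induction r with
    | nil =>
      intro d s hL hInv _ hidx _ _ hregs
      have hb : ¬ (Test.lt idx (.inp R)).Holds s := by
        simp only [Test.Holds, hidx, hregs _ hinp, hn, hL, List.append_nil]
        omega
      refine ⟨1, s, .loopFalse hb, by omega, ?_⟩
      rw [hL, List.append_nil]
      exact hInv
    | cons t r ih =>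
      intro d s hL hInv hone hidx hptr hmem hregs
      have hb : (Test.lt idx (.inp R)).Holds s := by
        simp only [Test.Holds, hidx, hregs _ hinp, hn, hL, List.length_append, List.length_cons]
        omega
      obtain ⟨h₁, h₂, h₃, h₄⟩ := step d t r s hL hInv hone hptr hmem hregs
      obtain ⟨m, hexec, hm⟩ := exec_eval _ s hfree
      obtain ⟨n, s', hexec', hn', hI⟩ := ih (d ++ [t]) _ (by simp [hL]) h₁ h₂
        (by simp [h₄, hidx]) h₃ (fun A hA => (hframe_mem s A hA).trans (hmem A hA))
        (fun x hx => (hframe_reg s x hx).trans (hregs x hx))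
      refine ⟨_, s', .loopTrue hb hexec hexec', ?_, hI⟩
      simp only [List.length_cons, mul_add]
      omega
  have hM1 : 1 ≤ M := by omega
  have hpre : ∀ x ∉ loopRegs, (((s₀.setReg one 1).setReg idx 0).setReg ptr 0).reg x
      = s₀.reg x := by
    intro x hx
    simp only [loopRegs, Set.mem_union, Set.mem_insert_iff, Set.mem_singleton_iff, not_or] at hx
    simp [State.setReg_reg, hx.1.1, hx.1.2.1, hx.1.2.2.1]
  obtain ⟨n, s', h₁, h₂, h₃⟩ := loop L [] (((s₀.setReg one 1).setReg idx 0).setReg ptr 0) rfl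
    (hcongr _ _ _ h₀ rfl hpre) (by simp [State.setReg_reg]) (by simp [State.setReg_reg])
    (by simp [State.setReg_reg]) (fun _ _ => rfl) (fun x hx => hpre x fun h => hx (Or.inr h))
  refine ⟨_, s', .seq .const (.seq .const (.seq .const h₁)), ?_, h₃⟩
  have h₅ : ((tupleStep R args p).cost + 1) * (L.length + 1)
      ≤ ((tupleStep R args p).cost + 1) * M := Nat.mul_le_mul_left _ hM
  simp only [forTuples, Prog.cost]
  nlinarith
/-! ### Writing the output database -/

/-- The input database, as listed by `L`, is in its place. -/
def HasInput (L : ℕ → List (List ℕ)) (s : State) : Prop :=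
  ∀ R, s.reg (.inp R) = (L R).length ∧ Stores (s.mem (.inp R)) 0 (L R).flatten

theorem hasInput_initState (L : ℕ → List (List ℕ)) : HasInput L (initState L) := fun R =>
  ⟨rfl, stores_iff.2 fun i _ => by simp [initState]⟩

theorem HasInput.congr {L : ℕ → List (List ℕ)} {s s' : State} (h : HasInput L s)
    (hr : ∀ R, s'.reg (.inp R) = s.reg (.inp R)) (hm : ∀ R, s'.mem (.inp R) = s.mem (.inp R)) :
    HasInput L s' := fun R => by
  rw [hr, hm]
  exact h R

/-- The output relation `R` consists of the tuples in `l`. -/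
def HasOutput (R : ℕ) (l : List (List ℕ)) (s : State) : Prop :=
  s.reg (.out R) = l.length ∧ Stores (s.mem (.out R)) 0 l.flatten

/-- Append the tuple of the values of the registers `rs` to the output relation `R`. -/
def emit (R : ℕ) : List Name → Prog
  | [] => .add (.out R) (.out R) one
  | r :: rs => .seq (.store (.out R) optr r) (.seq (.add optr optr one) (emit R rs))

theorem loopFree_emit (R : ℕ) (rs : List Name) : (emit R rs).LoopFree := by
  induction rs with
  | nil => simp [emit]
  | cons r rs ih => simp [emit, ih]

theorem regs_emit (R : ℕ) (rs : List Name) : (emit R rs).regs ⊆ {.out R, optr} := by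
  induction rs with
  | nil => simp [emit]
  | cons r rs ih => simpa [emit, Set.insert_subset_iff] using ih

theorem arrs_emit (R : ℕ) (rs : List Name) : (emit R rs).arrs ⊆ {.out R} := by
  induction rs with
  | nil => simp [emit]
  | cons r rs ih => simpa [emit] using ih

theorem eval_emit (R : ℕ) (rs : List Name) (hrs : optr ∉ rs) (s : State) (hone : s.reg one = 1)
    (l : List ℕ) (hl : Stores (s.mem (.out R)) 0 l) (hptr : s.reg optr = l.length) :
    Stores (((emit R rs).eval s).mem (.out R)) 0 (l ++ rs.map s.reg) ∧
      ((emit R rs).eval s).reg optr = (l ++ rs.map s.reg).length ∧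
      ((emit R rs).eval s).reg (.out R) = s.reg (.out R) + 1 := by
  induction rs generalizing s l with
  | nil => simpa [emit, State.setReg_reg, hone, hptr] using hl
  | cons r rs ih =>
    simp only [emit, Prog.eval]
    simp only [List.mem_cons, not_or] at hrs
    set s₁ := s.setMem (.out R) (s.reg optr) (s.reg r) with hs₁
    set s₂ := s₁.setReg optr (s₁.reg optr + s₁.reg one) with hs₂
    have hmap : rs.map s₂.reg = rs.map s.reg := by
      refine List.map_congr_left fun x hx => ?_
      have : x ≠ optr := by rintro rfl; exact hrs.2 hx
      simp [hs₂, hs₁, State.setReg_reg, this]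
    have := ih hrs.2 s₂ (by simp [hs₂, hs₁, State.setReg_reg, hone]) (l ++ [s.reg r]) (by
      rw [stores_append]
      refine ⟨hl.congr fun i hi => ?_, ?_⟩
      · simp only [hs₂, hs₁, State.setReg_mem, State.setMem_mem]
        rw [if_neg (by omega)]
      · simp [Stores, hs₂, hs₁, State.setMem_mem, hptr])
      (by simp [hs₂, hs₁, State.setReg_reg, hptr, hone])
    rw [hmap] at this
    simpa [hs₂, hs₁, State.setReg_reg] using this

/-- For every consistent tuple of the relation `R`, run `p` and output the registers `rs`. -/
def transfer (R : ℕ) (args : List ℕ) (p : Prog) (rs : List Name) : Prog :=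
  .seq (.const optr 0) (forTuples R args (.seq p (emit R rs)))

/-- The registers that the program run by `transfer` must not change. -/
def transferRegs : Set Name := {one, idx, ptr, optr} ∪ Set.range .inp ∪ Set.range .out

theorem runs_transfer {M R : ℕ} {args : List ℕ} {p : Prog} {rs : List Name}
    {L : ℕ → List (List ℕ)} {s₀ : State} {G : (ℕ → ℕ) → List ℕ} (hp : p.LoopFree)
    (hreg : ∀ x ∈ transferRegs, x ∉ p.regs) (harr : p.arrs = ∅) (hrs : optr ∉ rs)
    (hin : HasInput L s₀) (hlen : ∀ t ∈ L R, t.length = args.length) (hM : (L R).length + 1 ≤ M)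
    (hout : s₀.reg (.out R) = 0)
    (hG : ∀ t ∈ L R, Fits args t → ∀ s : State, (∀ A ∉ Set.range Name.out, s.mem A = s₀.mem A) →
      (∀ v ∈ args, s.reg (val v) = read args t v) →
      rs.map (p.eval s).reg = G (read args t)) :
    Runs M (transfer R args p rs) s₀
      (HasOutput R (((L R).filter (Fits args ·)).map fun t => G (read args t))) := by
  have hfree : (Prog.seq p (emit R rs)).LoopFree := ⟨hp, loopFree_emit R rs⟩
  have hregs : ∀ x ∈ transferRegs, x ≠ optr → x ≠ .out R →
      x ∉ (Prog.seq p (emit R rs)).regs := by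
    rintro x hx h₁ h₂ (h | h)
    · exact hreg x hx h
    · rcases regs_emit R rs h with h | h
      · exact h₂ h
      · exact h₁ h
  have harrs : ∀ A, A ≠ .out R → A ∉ (Prog.seq p (emit R rs)).arrs := by
    rintro A hA (h | h)
    · simp [harr] at h
    · exact hA (arrs_emit R rs h)
  refine Runs.seq (P := fun s => s = s₀.setReg optr 0) (runs_eval (by omega) (p := .const optr 0) trivial rfl) ?_
  rintro _ rfl
  refine (runs_forTuples (L := L R) (Inv := fun d s =>
    HasOutput R ((d.filter (Fits args ·)).map fun t => G (read args t)) s ∧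
      s.reg optr = ((d.filter (Fits args ·)).map fun t => G (read args t)).flatten.length)
    hfree ?_ (harrs _ (by simp)) (by simpa [State.setReg_reg] using (hin R).1)
    (by simpa using (hin R).2) hlen hM ?_ ?_ ?_ ?_).mono fun _ h => h.1
  · intro x hx
    simp only [Set.mem_insert_iff, Set.mem_singleton_iff] at hx
    rcases hx with rfl | rfl | rfl | rfl <;> refine hregs _ ?_ (by simp) (by simp) <;>
      simp [transferRegs]
  · rintro d s s' ⟨⟨h₁, h₂⟩, h₃⟩ hmem hr
    refine ⟨⟨?_, ?_⟩, ?_⟩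
    · rw [hr _ (by simp [loopRegs]), h₁]
    · rwa [hmem]
    · rw [hr _ (by simp [loopRegs]), h₃]
  · simp [HasOutput, State.setReg_reg, hout, Stores]
  · intro d t s ht h
    simpa [List.filter_append, ht] using h
  · rintro d t r s hL ht ⟨⟨h₁, h₂⟩, h₃⟩ hval hone hmem -
    have hone' : (p.eval s).reg one = 1 := by
      rw [eval_reg_eq hp s (hreg _ (by simp [transferRegs])), hone]
    have hr : ∀ x ∈ transferRegs, (p.eval s).reg x = s.reg x := fun x hx =>
      eval_reg_eq hp s (hreg x hx)
    have hm : (p.eval s).mem = s.mem := funext fun A => eval_mem_eq hp s (by simp [harr])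
    obtain ⟨h₄, h₅, h₆⟩ := eval_emit R rs hrs (p.eval s) hone' _ (by rw [hm]; exact h₂)
      (by rw [hr _ (by simp [transferRegs]), h₃])
    rw [hG t (by simp [hL]) ht s (fun A hA => by
      rw [hmem A (harrs A (by rintro rfl; exact hA ⟨R, rfl⟩))]; rfl) hval] at h₄ h₅
    rw [hr _ (by simp [transferRegs]), h₁] at h₆
    refine ⟨⟨?_, ?_⟩, ?_⟩
    · simpa [List.filter_append, ht] using h₆
    · simpa [List.filter_append, ht] using h₄
    · simpa [List.filter_append, ht] using h₅

/-- Apply `transfer` to several relations. -/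
theorem runs_transfers {ι : Type*} {M : ℕ} {Z : List ι} {R : ι → ℕ} {args : ι → List ℕ}
    {p : ι → Prog} {rs : ι → List Name} {L : ℕ → List (List ℕ)} {s₀ : State}
    {G : ι → (ℕ → ℕ) → List ℕ} (hR : (Z.map R).Nodup) (hp : ∀ z ∈ Z, (p z).LoopFree)
    (hreg : ∀ z ∈ Z, ∀ x ∈ transferRegs, x ∉ (p z).regs) (harr : ∀ z ∈ Z, (p z).arrs = ∅)
    (hrs : ∀ z ∈ Z, optr ∉ rs z) (hin : HasInput L s₀)
    (hlen : ∀ z ∈ Z, ∀ t ∈ L (R z), t.length = (args z).length) (hM1 : 1 ≤ M)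
    (hM : ∀ z ∈ Z, (L (R z)).length + 1 ≤ M) (hout : ∀ S, s₀.reg (.out S) = 0)
    (hG : ∀ z ∈ Z, ∀ t ∈ L (R z), Fits (args z) t → ∀ s : State,
      (∀ A ∉ Set.range Name.out, s.mem A = s₀.mem A) →
      (∀ v ∈ args z, s.reg (val v) = read (args z) t v) →
      (rs z).map ((p z).eval s).reg = G z (read (args z) t)) :
    Runs M (seqs (Z.map fun z => transfer (R z) (args z) (p z) (rs z))) s₀ fun s =>
      (∀ A ∉ Set.range Name.out, s.mem A = s₀.mem A) ∧
      ∃ Lo : ℕ → List (List ℕ), (∀ S, HasOutput S (Lo S) s) ∧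
        (∀ z ∈ Z, Lo (R z) =
          ((L (R z)).filter (Fits (args z) ·)).map fun t => G z (read (args z) t)) ∧
        ∀ S ∉ Z.map R, Lo S = [] := by
  refine (runs_seqs hM1 _ Z (fun d s =>
    (∀ A ∉ Set.range Name.out, s.mem A = s₀.mem A) ∧
    (∀ S, s.reg (.inp S) = s₀.reg (.inp S)) ∧
      ∃ Lo : ℕ → List (List ℕ), (∀ S, HasOutput S (Lo S) s) ∧
        (∀ z ∈ d, Lo (R z) =
          ((L (R z)).filter (Fits (args z) ·)).map fun t => G z (read (args z) t)) ∧
        ∀ S ∉ d.map R, Lo S = []) s₀ ?_ ?_).mono fun s h => ⟨h.1, h.2.2⟩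
  · exact ⟨fun _ _ => rfl, fun _ => rfl, fun _ => [], fun S => ⟨hout S, trivial⟩, by simp, by simp⟩
  · rintro d z r s hZ ⟨hmem, hinp, Lo, h₁, h₂, h₃⟩
    have hz : z ∈ Z := by simp [hZ]
    have hzd : R z ∉ d.map R := by
      rw [hZ, List.map_append, List.nodup_append] at hR
      exact fun h => hR.2.2 _ h _ (by simp) rfl
    have hframe_reg : ∀ x ∈ transferRegs, x ∉ loopRegs → x ≠ optr → x ≠ .out (R z) →
        x ∉ (transfer (R z) (args z) (p z) (rs z)).regs := by
      rintro x hx hx' h₁ h₂ (h | h)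
      · exact h₁ h
      · rcases regs_forTuples _ _ _ h with (h | h) | h
        · exact hreg z hz x hx h
        · rcases regs_emit _ _ h with h | h
          · exact h₂ h
          · exact h₁ h
        · exact hx' h
    have hframe_arr : ∀ A, A ≠ .out (R z) →
        A ∉ (transfer (R z) (args z) (p z) (rs z)).arrs := by
      rintro A hA (h | h)
      · exact h
      · rcases arrs_forTuples _ _ _ h with h | h
        · simp [harr z hz] at h
        · exact hA (arrs_emit _ _ h)
    have hrun := runs_transfer (M := M) (s₀ := s) (G := G z) (hp z hz) (hreg z hz) (harr z hz)
      (hrs z hz) (hin.congr hinp fun S => hmem _ (by simp)) (hlen z hz) (hM z hz)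
      (by rw [(h₁ (R z)).1, h₃ _ hzd]; rfl) (fun t ht hf s' hs' =>
        hG z hz t ht hf s' fun A hA => (hs' A hA).trans (hmem A hA))
    refine hrun.frame.mono ?_
    rintro s' ⟨ho, hr, hm⟩
    refine ⟨fun A hA => ?_, fun S => ?_, Function.update Lo (R z)
      (((L (R z)).filter (Fits (args z) ·)).map fun t => G z (read (args z) t)),
      fun S => ?_, ?_, ?_⟩
    · rw [hm A (hframe_arr A (by rintro rfl; exact hA ⟨_, rfl⟩)), hmem A hA]
    · rw [hr _ (hframe_reg _ (by simp [transferRegs]) (by simp [loopRegs]) (by simp) (by simp)),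
        hinp]
    · by_cases hS : S = R z
      · subst hS
        simpa using ho
      · rw [Function.update_of_ne hS]
        refine ⟨?_, ?_⟩
        · rw [hr _ (hframe_reg _ (by simp [transferRegs]) (by simp [loopRegs]) (by simp)
            (by simpa using hS)), (h₁ S).1]
        · rw [hm _ (hframe_arr _ (by simpa using hS))]
          exact (h₁ S).2
    · intro w hw
      rcases List.mem_append.1 hw with hw | hw
      · rw [Function.update_of_ne, h₂ w hw]
        rintro h
        exact hzd (h ▸ List.mem_map_of_mem hw)
      · obtain rfl : w = z := by simpa using hw
        simp
    · intro S hS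
      simp only [List.map_append, List.mem_append, List.map_cons, List.map_nil,
        List.mem_singleton, not_or] at hS
      rw [Function.update_of_ne hS.2, h₃ S hS.1]

theorem outputs_of_hasOutput {Lo : ℕ → List (List ℕ)} {s : State}
    (h : ∀ R, HasOutput R (Lo R) s) (hnd : ∀ R, (Lo R).Nodup) :
    Outputs s fun R => (Lo R).toFinset :=
  ⟨Lo, fun R => ⟨hnd R, rfl⟩, fun R => ⟨(h R).1, fun i hi => by
    simpa using stores_iff.1 (h R).2 i hi⟩⟩

end RAM

/-! ### The structure of the FD-extension -/

/-- The variable on the left-hand side of a unary dependency. -/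
def FD.src (φ : FD) : ℕ := φ.lhs.sup id

theorem FD.Unary.lhs_eq {φ : FD} (h : φ.Unary) : φ.lhs = {φ.src} := by
  obtain ⟨x, hx⟩ := Finset.card_eq_one.1 h
  simp [FD.src, hx]

/-- The value of `y` follows from that of `x` by a chain of unary dependencies. -/
def Determines (Δ : Finset FD) : ℕ → ℕ → Prop :=
  Relation.ReflTransGen fun x y => ∃ φ ∈ Δ, φ.src = x ∧ φ.rhs = y

/-- The right-hand sides of the listed dependencies can be appended to the list of variables, one
after the other: each is new, and the left-hand side is present already. -/
def Derives (Δ : Finset FD) : List ℕ → List FD → Prop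
  | _, [] => True
  | vs, φ :: es => φ ∈ Δ ∧ φ.src ∈ vs ∧ φ.rhs ∉ vs ∧ Derives Δ (vs ++ [φ.rhs]) es

theorem Derives.snoc {Δ : Finset FD} {vs : List ℕ} {es : List FD} {φ : FD} (h : Derives Δ vs es)
    (hφ : φ ∈ Δ) (hx : φ.src ∈ vs ++ es.map FD.rhs) (hy : φ.rhs ∉ vs ++ es.map FD.rhs) :
    Derives Δ vs (es ++ [φ]) := by
  induction es generalizing vs with
  | nil => simpa [Derives, hφ] using ⟨by simpa using hx, by simpa using hy⟩
  | cons ψ es ih =>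
    obtain ⟨h₁, h₂, h₃, h₄⟩ := h
    exact ⟨h₁, h₂, h₃, ih h₄ (by simpa using hx) (by simpa using hy)⟩

theorem Derives.mem {Δ : Finset FD} {vs : List ℕ} {es : List FD} (h : Derives Δ vs es) {φ : FD}
    (hφ : φ ∈ es) : φ ∈ Δ := by
  induction es generalizing vs with
  | nil => simp at hφ
  | cons ψ es ih =>
    rcases List.mem_cons.1 hφ with rfl | hφ
    · exact h.1
    · exact ih h.2.2.2 hφ

theorem Derives.exists_determines {Δ : Finset FD} {vs : List ℕ} {es : List FD}
    (h : Derives Δ vs es) {y : ℕ} (hy : y ∈ vs ++ es.map FD.rhs) :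
    ∃ x ∈ vs, Determines Δ x y := by
  induction es generalizing vs with
  | nil => exact ⟨y, by simpa using hy, .refl⟩
  | cons φ es ih =>
    obtain ⟨h₁, h₂, -, h₄⟩ := h
    obtain ⟨x, hx, hxy⟩ := ih h₄ (by simpa using hy)
    rcases List.mem_append.1 hx with hx | hx
    · exact ⟨x, hx, hxy⟩
    · obtain rfl : x = φ.rhs := by simpa using hx
      exact ⟨φ.src, h₂, .head ⟨φ, h₁, rfl, rfl⟩ hxy⟩

/-- The variables of an atom, followed by those that its list of dependencies appends. -/
def extArgs (z : Atom × List FD) : List ℕ := z.1.args ++ z.2.map FD.rhs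

theorem mem_extArgs {z : Atom × List FD} {v : ℕ} (h : v ∈ z.1.args) : v ∈ extArgs z :=
  List.mem_append_left _ h

/-- `Q'` is the FD-extension of `Q`, where `Z` lists the atoms of `Q` together with the dependencies
of `Δ` that have been used to extend them. -/
structure Presents (Q : CQ) (Δ : Finset FD) (Q' : CQ) (Z : List (Atom × List FD)) : Prop where
  atoms : Q.atoms = Z.map Prod.fst
  atoms_ext : Q'.atoms = Z.map fun z => ⟨z.1.rel, extArgs z⟩
  nodup : (Z.map fun z => z.1.rel).Nodup
  derives : ∀ z ∈ Z, Derives Δ z.1.args z.2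
  free_subset : Q.free ⊆ Q'.free
  free_determined : ∀ y ∈ Q'.free, ∃ x ∈ Q.free, Determines Δ x y
  closed : ∀ z ∈ Z, ∀ φ ∈ Δ, φ.src ∈ extArgs z → φ.rhs ∈ extArgs z
  free_closed : ∀ φ ∈ Δ, φ.src ∈ Q'.free → φ.rhs ∈ Q'.free
  on : ∀ φ ∈ Δ, ∃ z ∈ Z, z.1.rel = φ.rel ∧ φ.src ∈ z.1.args ∧ φ.rhs ∈ z.1.args
  lhs_eq : ∀ φ ∈ Δ, φ.lhs = {φ.src}
  safe : ∀ x ∈ Q.free, ∃ z ∈ Z, x ∈ z.1.args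

/-- Every dependency that an extension adds has both sides in common with an original one, so that
the original dependencies account for all steps. -/
theorem exists_extension_list {Q : CQ} {Δ : Finset FD} (hunary : ∀ φ ∈ Δ, φ.Unary)
    {p : CQ × Finset FD} (h : Relation.ReflTransGen ExtStep (Q, Δ) p) :
    (∃ Z : List (Atom × List FD), Q.atoms = Z.map Prod.fst ∧
      p.1.atoms = Z.map (fun z => ⟨z.1.rel, extArgs z⟩) ∧ ∀ z ∈ Z, Derives Δ z.1.args z.2) ∧
    (∀ φ ∈ p.2, ∃ ψ ∈ Δ, ψ.lhs = φ.lhs ∧ ψ.rhs = φ.rhs) ∧ Δ ⊆ p.2 ∧ Q.free ⊆ p.1.free ∧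
    ∀ y ∈ p.1.free, ∃ x ∈ Q.free, Determines Δ x y := by
  induction h with
  | refl =>
    refine ⟨⟨Q.atoms.map fun a => (a, []), ?_, ?_, ?_⟩, fun φ hφ => ⟨φ, hφ, rfl, rfl⟩,
      Finset.Subset.refl _, Finset.Subset.refl _, fun y hy => ⟨y, hy, .refl⟩⟩
    · simp [Function.comp_def]
    · simp [Function.comp_def, extArgs]
    · simp [Derives]
  | tail _ hstep ih =>
    obtain ⟨⟨Z, hZ, hZ', hd⟩, hfd, hsub, hfree, hreach⟩ := ih
    cases hstep with
    | @atom l₁ l₂ a free Δ₁ φ hφ hX hy =>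
      obtain ⟨ψ, hψ, hl, hr⟩ := hfd φ hφ
      refine ⟨?_, ?_, hsub.trans (Finset.subset_insert _ _), hfree, hreach⟩
      · obtain ⟨Z₁, Z₂, rfl, h₁, h₂⟩ := List.map_eq_append_iff.1 hZ'.symm
        obtain ⟨z, Z₃, rfl, h₃, h₄⟩ := List.map_eq_cons_iff.1 h₂
        refine ⟨Z₁ ++ (z.1, z.2 ++ [ψ]) :: Z₃, by simpa using hZ, ?_, ?_⟩
        · simp [← h₁, ← h₃, ← h₄, extArgs, hr]
        · intro w hw
          simp only [List.mem_append, List.mem_cons] at hw hd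
          rcases hw with hw | rfl | hw
          · exact hd w (Or.inl hw)
          · refine (hd z (by simp)).snoc hψ ?_ ?_
            · have : ψ.src ∈ φ.lhs := by rw [← hl, (hunary ψ hψ).lhs_eq]; simp
              have := hX this
              simpa [← h₃, Atom.vars, extArgs] using this
            · simpa [← h₃, Atom.vars, extArgs, hr] using hy
          · exact hd w (Or.inr (Or.inr hw))
      · intro χ hχ
        rcases Finset.mem_insert.1 hχ with rfl | hχ
        · exact ⟨ψ, hψ, hl, hr⟩
        · exact hfd χ hχ
    | @free atoms free Δ₁ φ hφ hX hy =>
      obtain ⟨ψ, hψ, hl, hr⟩ := hfd φ hφ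
      refine ⟨⟨Z, hZ, hZ', hd⟩, hfd, hsub, hfree.trans (Finset.subset_insert _ _), ?_⟩
      intro y hy'
      rcases Finset.mem_insert.1 hy' with rfl | hy'
      · have : ψ.src ∈ φ.lhs := by rw [← hl, (hunary ψ hψ).lhs_eq]; simp
        obtain ⟨x, hx, hxy⟩ := hreach _ (hX this)
        exact ⟨x, hx, hxy.tail ⟨ψ, hψ, rfl, hr⟩⟩
      · exact hreach y hy'

theorem IsFDExtension.exists_presents {Q Q' : CQ} {Δ Δ' : Finset FD} (hsafe : Q.Safe)
    (hsjf : Q.SelfJoinFree) (hΔ : ∀ φ ∈ Δ, φ.On Q) (hunary : ∀ φ ∈ Δ, φ.Unary)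
    (hext : IsFDExtension Q Δ Q' Δ') : ∃ Z, Presents Q Δ Q' Z := by
  obtain ⟨⟨Z, hZ, hZ', hd⟩, -, hsub, hfree, hreach⟩ := exists_extension_list hunary hext.1
  have hl : ∀ φ ∈ Δ, φ.lhs = {φ.src} := fun φ hφ => (hunary φ hφ).lhs_eq
  refine ⟨Z, hZ, hZ', ?_, hd, hfree, hreach, ?_, ?_, ?_, hl, ?_⟩
  · simpa [CQ.SelfJoinFree, hZ, Function.comp_def] using hsjf
  · intro z hz φ hφ hx
    by_contra hy
    have hmem : (⟨z.1.rel, extArgs z⟩ : Atom) ∈ Q'.atoms := by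
      rw [hZ']
      exact List.mem_map.2 ⟨z, hz, rfl⟩
    obtain ⟨l₁, l₂, h₁⟩ := List.append_of_mem hmem
    have hQ' : Q' = ⟨l₁ ++ ⟨z.1.rel, extArgs z⟩ :: l₂, Q'.free⟩ := by rw [← h₁]
    have hstep := ExtStep.atom (l₁ := l₁) (l₂ := l₂) (a := ⟨z.1.rel, extArgs z⟩)
      (free := Q'.free) (hsub hφ) (by simpa [hl φ hφ, Atom.vars] using hx)
      (by simpa [Atom.vars] using hy)
    rw [← hQ'] at hstep
    exact hext.2 _ hstep
  · intro φ hφ hx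
    by_contra hy
    exact hext.2 _ (ExtStep.free (atoms := Q'.atoms) (hsub hφ) (by simpa [hl φ hφ] using hx) hy)
  · intro φ hφ
    obtain ⟨a, ha, hr, hx, hy⟩ := hΔ φ hφ
    rw [hZ] at ha
    obtain ⟨z, hz, rfl⟩ := List.mem_map.1 ha
    exact ⟨z, hz, hr, by simpa [hl φ hφ, Atom.vars] using hx, by simpa [Atom.vars] using hy⟩
  · intro x hx
    obtain ⟨a, ha, hxa⟩ := hsafe x hx
    rw [hZ] at ha
    obtain ⟨z, hz, rfl⟩ := List.mem_map.1 ha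
    exact ⟨z, hz, by simpa [Atom.vars] using hxa⟩

theorem assigns_map {a : Atom} {h : ℕ → ℕ} {x c : ℕ} (hx : x ∈ a.args) :
    a.Assigns (a.args.map h) x c ↔ h x = c := by
  have hz : a.args.zip (a.args.map h) = a.args.map fun v => (v, h v) := by
    simpa using List.zip_map' (f := id) (g := h) (l := a.args)
  rw [Atom.Assigns, hz]
  constructor
  · intro H
    exact H (x, h x) (List.mem_map.2 ⟨x, hx, rfl⟩) rfl
  · rintro rfl p hp rfl
    obtain ⟨y, -, rfl⟩ := List.mem_map.1 hp
    rfl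

namespace Presents

variable {Q Q' : CQ} {Δ : Finset FD} {Z : List (Atom × List FD)}

theorem isHom_iff (hP : Presents Q Δ Q' Z) {I : Database} {h : ℕ → ℕ} :
    Q.IsHom I h ↔ ∀ z ∈ Z, z.1.args.map h ∈ I z.1.rel := by
  simp [CQ.IsHom, hP.atoms]

theorem isHom_ext_iff (hP : Presents Q Δ Q' Z) {I : Database} {h : ℕ → ℕ} :
    Q'.IsHom I h ↔ ∀ z ∈ Z, (extArgs z).map h ∈ I z.1.rel := by
  rw [CQ.IsHom, hP.atoms_ext, List.forall_mem_map]

theorem eq_of_rel_eq (hP : Presents Q Δ Q' Z) {z w : Atom × List FD} (hz : z ∈ Z) (hw : w ∈ Z)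
    (h : z.1.rel = w.1.rel) : z = w :=
  List.inj_on_of_nodup_map hP.nodup hz hw h

theorem mem_extArgs_of_determines (hP : Presents Q Δ Q' Z) {z : Atom × List FD} (hz : z ∈ Z)
    {x y : ℕ} (h : Determines Δ x y) (hx : x ∈ extArgs z) : y ∈ extArgs z := by
  induction h with
  | refl => exact hx
  | tail _ h ih =>
    obtain ⟨φ, hφ, rfl, rfl⟩ := h
    exact hP.closed z hz φ hφ ih

theorem mem_free_of_determines (hP : Presents Q Δ Q' Z) {x y : ℕ} (h : Determines Δ x y)
    (hx : x ∈ Q'.free) : y ∈ Q'.free := by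
  induction h with
  | refl => exact hx
  | tail _ h ih =>
    obtain ⟨φ, hφ, rfl, rfl⟩ := h
    exact hP.free_closed φ hφ ih

theorem size_le (hP : Presents Q Δ Q' Z) {I : Database} {L : ℕ → List (List ℕ)}
    (hL : RAM.IsListing L I) {z : Atom × List FD} (hz : z ∈ Z) :
    (L z.1.rel).length + 1 ≤ I.size Q + 1 := by
  rw [← List.toFinset_card_of_nodup (hL _).1, (hL _).2]
  refine Nat.succ_le_succ (Finset.single_le_sum (f := fun R => (I R).card) (fun _ _ => zero_le) ?_)
  simpa [CQ.rels, hP.atoms] using ⟨z.1, ⟨z.2, hz⟩, rfl⟩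

theorem size_ext (hP : Presents Q Δ Q' Z) (I : Database) : I.size Q' = I.size Q := by
  simp [Database.size, CQ.rels, hP.atoms, hP.atoms_ext, Function.comp_def]

/-- In a database that satisfies the dependencies, homomorphisms respect them. -/
theorem eq_of_satisfies (hP : Presents Q Δ Q' Z) {I : Database} (hI : I.Satisfies Q Δ) {φ : FD}
    (hφ : φ ∈ Δ) {z : Atom × List FD} (hz : z ∈ Z) (hr : z.1.rel = φ.rel) {h₁ h₂ : ℕ → ℕ}
    (hh₁ : z.1.args.map h₁ ∈ I z.1.rel) (hh₂ : z.1.args.map h₂ ∈ I z.1.rel)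
    (h : h₁ φ.src = h₂ φ.src) : h₁ φ.rhs = h₂ φ.rhs := by
  obtain ⟨w, hw, hw', hx, hy⟩ := hP.on φ hφ
  obtain rfl := hP.eq_of_rel_eq hz hw (hr.trans hw'.symm)
  rw [hr] at hh₁ hh₂
  refine hI φ hφ z.1 (by rw [hP.atoms]; exact List.mem_map_of_mem hz) hr _ hh₁ _ hh₂ ?_ _ _
    ((assigns_map hy).2 rfl) ((assigns_map hy).2 rfl)
  intro x hx'
  rw [hP.lhs_eq φ hφ, Finset.mem_singleton] at hx'
  subst hx'
  exact ⟨_, (assigns_map hx).2 rfl, (assigns_map hx).2 h.symm⟩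

theorem eq_of_determines (hP : Presents Q Δ Q' Z) {I : Database} (hI : I.Satisfies Q Δ)
    {h₁ h₂ : ℕ → ℕ} (hh₁ : Q.IsHom I h₁) (hh₂ : Q.IsHom I h₂) {x y : ℕ} (hxy : Determines Δ x y)
    (h : h₁ x = h₂ x) : h₁ y = h₂ y := by
  induction hxy with
  | refl => exact h
  | tail _ hφ ih =>
    obtain ⟨φ, hφ, rfl, rfl⟩ := hφ
    obtain ⟨z, hz, hr, -, -⟩ := hP.on φ hφ
    exact hP.eq_of_satisfies hI hφ hz hr (hP.isHom_iff.1 hh₁ z hz) (hP.isHom_iff.1 hh₂ z hz) ih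

end Presents

namespace RAM

/-! ### Lookup tables and the translation of answers -/

/-- For every consistent tuple of `R`, run `p` and store the register `r` in the cell of the array
`A` that is given by the register `k`. -/
def fill (R : ℕ) (args : List ℕ) (p : Prog) (A k r : Name) : Prog :=
  forTuples R args (.seq p (.store A k r))

theorem runs_fill {M R : ℕ} {args : List ℕ} {p : Prog} {A k r : Name} {L : ℕ → List (List ℕ)}
    {s₀ : State} {K V : List ℕ → ℕ} (hp : p.LoopFree)
    (hreg : ∀ x ∈ transferRegs, x ∉ p.regs) (harr : p.arrs = ∅) (hA : A ∉ Set.range Name.inp)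
    (hin : HasInput L s₀) (hlen : ∀ t ∈ L R, t.length = args.length) (hM : (L R).length + 1 ≤ M)
    (hKV : ∀ t ∈ L R, Fits args t → ∀ s : State, (∀ B, B ≠ A → s.mem B = s₀.mem B) →
      (∀ v ∈ args, s.reg (val v) = read args t v) →
      (p.eval s).reg k = K t ∧ (p.eval s).reg r = V t)
    (hfun : ∀ t ∈ L R, ∀ t' ∈ L R, Fits args t → Fits args t' → K t = K t' → V t = V t') :
    Runs M (fill R args p A k r) s₀ fun s =>
      (∀ t ∈ L R, Fits args t → s.mem A (K t) = V t) ∧ HasInput L s ∧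
      (∀ S, s.reg (.out S) = s₀.reg (.out S)) ∧ ∀ B, B ≠ A → s.mem B = s₀.mem B := by
  have harrs : ∀ B, B ≠ A → B ∉ (Prog.seq p (.store A k r)).arrs := by
    intro B hB
    simp [harr, hB]
  have hmem : ∀ s, (p.eval s).mem = s.mem := fun s =>
    funext fun B => eval_mem_eq hp s (by simp [harr])
  refine (runs_forTuples (L := L R) (p := .seq p (.store A k r)) (R := R) (M := M)
    (Inv := fun d s => (∀ t ∈ d, t ∈ L R) → ∀ t ∈ d, Fits args t → s.mem A (K t) = V t)
    ⟨hp, trivial⟩ ?_ (harrs _ fun h => hA ⟨R, h⟩)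
    (hin R).1 (hin R).2 hlen hM ?_ ?_ ?_ ?_).frame.mono ?_
  · intro x hx
    simp only [Prog.regs, Set.union_empty]
    refine hreg x ?_
    simp only [Set.mem_insert_iff, Set.mem_singleton_iff] at hx
    rcases hx with rfl | rfl | rfl | rfl <;> simp [transferRegs]
  · intro d s s' h hm _
    rwa [hm]
  · simp
  · intro d t s ht h hL t' ht' hf
    rcases List.mem_append.1 ht' with h' | h'
    · exact h (fun t ht => hL t (by simp [ht])) t' h' hf
    · obtain rfl : t' = t := by simpa using h'
      exact absurd hf ht
  · intro d t l s hL ht h hval _ hm _ hL' t' ht' hf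
    have htL : t ∈ L R := by simp [hL]
    obtain ⟨h₁, h₂⟩ := hKV t htL ht s (fun B hB => hm B (harrs B hB)) hval
    simp only [Prog.eval, State.setMem_mem, h₁, h₂, hmem, true_and]
    rcases List.mem_append.1 ht' with h' | h'
    · split_ifs with hK
      · exact hfun t htL t' (hL' t' ht') ht hf hK.symm
      · exact h (fun t ht => hL' t (by simp [ht])) t' h' hf
    · obtain rfl : t' = t := by simpa using h'
      simp
  · rintro s ⟨h₁, h₂, h₃⟩
    have hfr : ∀ x ∈ transferRegs, x ∉ loopRegs →
        s.reg x = s₀.reg x := by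
      refine fun x hx hx' => h₂ x fun h => ?_
      rcases regs_forTuples _ _ _ h with h | h
      · exact hreg x hx (by simpa using h)
      · exact hx' h
    have hfm : ∀ B, B ≠ A → s.mem B = s₀.mem B := fun B hB =>
      h₃ B fun h => harrs B hB (arrs_forTuples _ _ _ h)
    refine ⟨h₁ fun _ => id, hin.congr (fun S => hfr _ ?_ ?_) (fun S => hfm _ ?_),
      fun S => hfr _ ?_ ?_, hfm⟩
    · simp [transferRegs]
    · simp [loopRegs]
    · rintro h
      exact hA ⟨S, h⟩
    · simp [transferRegs]
    · simp [loopRegs]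

theorem mem_iff_of_isListing {L : ℕ → List (List ℕ)} {I : Database} (hL : IsListing L I) {R : ℕ}
    {t : List ℕ} : t ∈ L R ↔ t ∈ I R := by
  rw [← (hL R).2, List.mem_toFinset]

/-- The tuples of a database that has been made by `transfer`. -/
theorem mem_transfer_iff {ι : Type*} {Z : List ι} {R : ι → ℕ} {args : ι → List ℕ}
    {G : ι → (ℕ → ℕ) → List ℕ} {L Lo : ℕ → List (List ℕ)} {I : Database} (hL : IsListing L I)
    (hLo : ∀ z ∈ Z, Lo (R z) =
      ((L (R z)).filter (Fits (args z) ·)).map fun t => G z (read (args z) t))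
    (hLo' : ∀ S ∉ Z.map R, Lo S = [])
    (hG : ∀ z ∈ Z, ∀ h h' : ℕ → ℕ, (∀ v ∈ args z, h v = h' v) → G z h = G z h')
    {S : ℕ} {t : List ℕ} :
    t ∈ Lo S ↔ ∃ z ∈ Z, R z = S ∧ ∃ h : ℕ → ℕ, (args z).map h ∈ I S ∧ t = G z h := by
  constructor
  · intro ht
    by_cases hS : S ∈ Z.map R
    · obtain ⟨z, hz, rfl⟩ := List.mem_map.1 hS
      rw [hLo z hz] at ht
      obtain ⟨t', ht', rfl⟩ := List.mem_map.1 ht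
      obtain ⟨ht', hf⟩ := List.mem_filter.1 ht'
      have hf : (args z).map (read (args z) t') = t' := of_decide_eq_true hf
      exact ⟨z, hz, rfl, _, by rw [hf]; exact (mem_iff_of_isListing hL).1 ht', rfl⟩
    · simp [hLo' S hS] at ht
  · rintro ⟨z, hz, rfl, h, hh, rfl⟩
    rw [hLo z hz]
    refine List.mem_map.2 ⟨_, List.mem_filter.2 ⟨(mem_iff_of_isListing hL).2 hh, ?_⟩,
      hG z hz _ _ fun v hv => read_map h hv⟩
    simpa using fits_map _ _

theorem nodup_transfer {ι : Type*} {Z : List ι} {R : ι → ℕ} {args : ι → List ℕ}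
    {G : ι → (ℕ → ℕ) → List ℕ} {L Lo : ℕ → List (List ℕ)} {I : Database} (hL : IsListing L I)
    (hLo : ∀ z ∈ Z, Lo (R z) =
      ((L (R z)).filter (Fits (args z) ·)).map fun t => G z (read (args z) t))
    (hLo' : ∀ S ∉ Z.map R, Lo S = [])
    (hG : ∀ z ∈ Z, ∀ h h' : ℕ → ℕ, (args z).map h ∈ I (R z) → (args z).map h' ∈ I (R z) →
      G z h = G z h' → ∀ v ∈ args z, h v = h' v) (S : ℕ) : (Lo S).Nodup := by
  by_cases hS : S ∈ Z.map R
  · obtain ⟨z, hz, rfl⟩ := List.mem_map.1 hS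
    rw [hLo z hz]
    refine List.Nodup.map_on ?_ ((hL _).1.filter _)
    intro t ht t' ht' h
    obtain ⟨ht, hf⟩ := List.mem_filter.1 ht
    obtain ⟨ht', hf'⟩ := List.mem_filter.1 ht'
    have hf : (args z).map (read (args z) t) = t := of_decide_eq_true hf
    have hf' : (args z).map (read (args z) t') = t' := of_decide_eq_true hf'
    rw [← hf, ← hf']
    refine List.map_congr_left (hG z hz _ _ ?_ ?_ h)
    · rw [hf]; exact (mem_iff_of_isListing hL).1 ht
    · rw [hf']; exact (mem_iff_of_isListing hL).1 ht'
  · simp [hLo' S hS]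

/-- An answer can be translated variable by variable. -/
theorem computesAnswer_seqs {Q Q' : CQ} (f : ℕ → Prog) (hf : ∀ y, (f y).LoopFree)
    (hreg : ∀ y, (f y).regs ⊆ {.ansOut y}) (harr : ∀ y, (f y).arrs = ∅) (mem : Name → ℕ → ℕ)
    (q' : Q'.Answer) (q : Q.Answer)
    (h : ∀ y : Q.free, ∀ s : State, s.mem = mem → (∀ x : Q'.free, s.reg (.ansIn x) = q' x) →
      ((f y).eval s).reg (.ansOut y) = q y) :
    ComputesAnswer (seqs (Q.free.toList.map f)) (seqs (Q.free.toList.map f)).cost mem q' q := by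
  intro s hs hin
  have hrun : Runs 1 (seqs (Q.free.toList.map f)) s fun s' => s'.mem = mem ∧
      (∀ x : Q'.free, s'.reg (.ansIn x) = q' x) ∧
      ∀ y : Q.free, y.1 ∈ Q.free.toList → s'.reg (.ansOut y) = q y := by
    refine runs_seqs le_rfl f _ (fun d s' => s'.mem = mem ∧
      (∀ x : Q'.free, s'.reg (.ansIn x) = q' x) ∧
      ∀ y : Q.free, y.1 ∈ d → s'.reg (.ansOut y) = q y) s ⟨hs, hin, by simp⟩ ?_
    rintro d y r s hd ⟨h₁, h₂, h₃⟩
    have hy : y ∈ Q.free := Finset.mem_toList.1 (by simp [hd])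
    refine runs_eval le_rfl (hf y) ⟨?_, fun x => ?_, fun w hw => ?_⟩
    · rw [← h₁]
      exact funext fun A => eval_mem_eq (hf y) s (by simp [harr])
    · rw [eval_reg_eq (hf y) s (fun hx => by simpa using hreg y hx), h₂]
    · by_cases hwy : w.1 = y
      · subst hwy
        exact h w s h₁ h₂
      · rw [eval_reg_eq (hf y) s (fun hx => hwy (by simpa using hreg y hx))]
        refine h₃ w ?_
        simpa [hwy] using hw
  obtain ⟨n, s', h₁, h₂, h₃, -, h₄⟩ := hrun
  exact ⟨n, s', h₁, by simpa using h₂, h₃, fun y => h₄ y (Finset.mem_toList.2 y.2)⟩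

end RAM

theorem CQ.weight_eq_sum {Q : CQ} {w : WeightFn} {q : Q.Answer} {h : ℕ → ℕ}
    (hq : ∀ x : Q.free, q x = h x) : Q.weight w q = ∑ x ∈ Q.free, w x (h x) := by
  rw [CQ.weight, ← Finset.sum_coe_sort Q.free fun x => w x (h x)]
  exact Finset.sum_congr rfl fun x _ => by rw [hq]

namespace Presents

variable {Q Q' : CQ} {Δ : Finset FD} {Z : List (Atom × List FD)}

theorem length_eq (hP : Presents Q Δ Q' Z) {I : Database} (hI : I.Over Q)
    {z : Atom × List FD} (hz : z ∈ Z) {t : List ℕ} (ht : t ∈ I z.1.rel) :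
    t.length = z.1.args.length := by
  obtain ⟨a, ha, hr, hl⟩ := hI _ t ht
  rw [hP.atoms] at ha
  obtain ⟨w, hw, rfl⟩ := List.mem_map.1 ha
  rw [hl, hP.eq_of_rel_eq hw hz hr]

theorem length_eq_ext (hP : Presents Q Δ Q' Z) {I : Database} (hI : I.Over Q')
    {z : Atom × List FD} (hz : z ∈ Z) {t : List ℕ} (ht : t ∈ I z.1.rel) :
    t.length = (extArgs z).length := by
  obtain ⟨a, ha, hr, hl⟩ := hI _ t ht
  rw [hP.atoms_ext] at ha
  obtain ⟨w, hw, rfl⟩ := List.mem_map.1 ha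
  rw [hl, hP.eq_of_rel_eq hw hz hr]

end Presents

/-! ### The reduction from the query to its extension -/

namespace RAM

/-- The array that holds the dependency as a function. -/
abbrev tab (φ : FD) : Name := .work (Nat.pair 2 (Nat.pair φ.rel (Nat.pair φ.src φ.rhs)))

/-- Append the values that the dependencies `es` determine, as stored in the tables `M`. -/
def extend (M : Name → ℕ → ℕ) : List FD → (ℕ → ℕ) → ℕ → ℕ
  | [], h => h
  | φ :: es, h => extend M es (Function.update h φ.rhs (M (tab φ) (h φ.src)))

theorem extend_apply_of_mem {M : Name → ℕ → ℕ} {Δ : Finset FD} {vs : List ℕ} {es : List FD}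
    (hd : Derives Δ vs es) (h : ℕ → ℕ) {v : ℕ} (hv : v ∈ vs) : extend M es h v = h v := by
  induction es generalizing vs h with
  | nil => rfl
  | cons φ es ih =>
    obtain ⟨-, -, h₃, h₄⟩ := hd
    rw [extend, ih h₄ _ (by simp [hv]), Function.update_of_ne]
    rintro rfl
    exact h₃ hv

theorem extend_congr {M : Name → ℕ → ℕ} {Δ : Finset FD} {vs : List ℕ} {es : List FD}
    (hd : Derives Δ vs es) {h h' : ℕ → ℕ} (hh : ∀ v ∈ vs, h v = h' v) :
    ∀ v ∈ vs ++ es.map FD.rhs, extend M es h v = extend M es h' v := by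
  induction es generalizing vs h h' with
  | nil => simpa [extend] using hh
  | cons φ es ih =>
    obtain ⟨-, h₂, h₃, h₄⟩ := hd
    intro v hv
    refine ih h₄ ?_ v (by simpa using hv)
    intro v hv
    by_cases hv' : v = φ.rhs
    · subst hv'
      simp [hh _ h₂]
    · rw [Function.update_of_ne hv', Function.update_of_ne hv']
      exact hh v (by simpa [hv'] using hv)

theorem extend_congr_tables {M M' : Name → ℕ → ℕ} (hM : ∀ φ, M (tab φ) = M' (tab φ))
    (es : List FD) (h : ℕ → ℕ) : extend M es h = extend M' es h := by
  induction es generalizing h with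
  | nil => rfl
  | cons φ es ih => simp only [extend, ih, hM]

theorem extend_eq_self {M : Name → ℕ → ℕ} {es : List FD} {h : ℕ → ℕ}
    (hh : ∀ φ ∈ es, M (tab φ) (h φ.src) = h φ.rhs) : extend M es h = h := by
  induction es with
  | nil => rfl
  | cons φ es ih =>
    rw [extend, hh φ (by simp), Function.update_eq_self]
    exact ih fun ψ hψ => hh ψ (by simp [hψ])

/-- Look up the value of the right-hand side of the dependency. -/
def lookup (φ : FD) : Prog := .load (val φ.rhs) (tab φ) (val φ.src)

theorem eval_lookups {Δ : Finset FD} {vs : List ℕ} {es : List FD} (hd : Derives Δ vs es)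
    (h : ℕ → ℕ) (s : State) (hs : ∀ v ∈ vs, s.reg (val v) = h v) :
    ∀ v ∈ vs ++ es.map FD.rhs,
      ((seqs (es.map lookup)).eval s).reg (val v) = extend s.mem es h v := by
  induction es generalizing vs h s with
  | nil => simpa [extend] using hs
  | cons φ es ih =>
    obtain ⟨-, h₂, h₃, h₄⟩ := hd
    intro v hv
    simp only [List.map_cons, seqs_cons, Prog.eval, extend]
    refine ih h₄ _ ((lookup φ).eval s) ?_ v (by simpa using hv)
    intro v hv
    by_cases hv' : v = φ.rhs
    · subst hv'
      simp [lookup, State.setReg_reg, hs _ h₂]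
    · rw [Function.update_of_ne hv', ← hs v (by simpa [hv'] using hv)]
      simp [lookup, State.setReg_reg, hv']

/-- Tabulate all dependencies; `φ` is read off the atom `at' φ`. -/
noncomputable def fillTables (Δ : Finset FD) (atomOf : FD → List ℕ) : Prog :=
  seqs (Δ.toList.map fun φ => fill φ.rel (atomOf φ) .skip (tab φ) (val φ.src) (val φ.rhs))

end RAM

namespace Presents

open RAM

variable {Q Q' : CQ} {Δ : Finset FD} {Z : List (Atom × List FD)}

theorem runs_fillTables (hP : Presents Q Δ Q' Z) {I : Database} (hI : I.Over Q)
    (hsat : I.Satisfies Q Δ) {L : ℕ → List (List ℕ)} (hL : IsListing L I)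
    {atomOf : FD → Atom × List FD}
    (hat : ∀ φ ∈ Δ, atomOf φ ∈ Z ∧ (atomOf φ).1.rel = φ.rel ∧ φ.src ∈ (atomOf φ).1.args ∧
      φ.rhs ∈ (atomOf φ).1.args) :
    Runs (I.size Q + 1) (fillTables Δ fun φ => (atomOf φ).1.args) (initState L) fun s =>
      HasInput L s ∧ (∀ S, s.reg (.out S) = 0) ∧
      ∀ φ ∈ Δ, ∀ h, Q.IsHom I h → s.mem (tab φ) (h φ.src) = h φ.rhs := by
  refine (runs_seqs (by omega) _ Δ.toList (fun d s => HasInput L s ∧ (∀ S, s.reg (.out S) = 0) ∧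
    ∀ φ ∈ d, ∀ t ∈ L φ.rel, Fits (atomOf φ).1.args t →
      s.mem (tab φ) (read (atomOf φ).1.args t φ.src) = read (atomOf φ).1.args t φ.rhs)
    (initState L) ⟨hasInput_initState L, fun S => rfl, by simp⟩ ?_).mono ?_
  · rintro d φ r s hd ⟨h₁, h₂, h₃⟩
    have hφ : φ ∈ Δ := Finset.mem_toList.1 (by simp [hd])
    obtain ⟨hz, hr, hx, hy⟩ := hat φ hφ
    refine (runs_fill (p := .skip) (K := fun t => read (atomOf φ).1.args t φ.src)
      (V := fun t => read (atomOf φ).1.args t φ.rhs) trivial (by simp) rfl (by simp) h₁ ?_ ?_ ?_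
      ?_).mono ?_
    · intro t ht
      exact hP.length_eq hI hz (by rw [hr]; exact (mem_iff_of_isListing hL).1 ht)
    · rw [← hr]
      exact hP.size_le hL hz
    · intro t ht hf s hs hval
      exact ⟨hval _ hx, hval _ hy⟩
    · intro t ht t' ht' hf hf' hK
      refine hP.eq_of_satisfies hsat hφ hz hr ?_ ?_ hK
      · rw [hf, hr]; exact (mem_iff_of_isListing hL).1 ht
      · rw [hf', hr]; exact (mem_iff_of_isListing hL).1 ht'
    · rintro s' ⟨h₄, h₅, h₆, h₇⟩
      refine ⟨h₅, fun S => (h₆ S).trans (h₂ S), ?_⟩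
      intro ψ hψ
      by_cases hψφ : ψ = φ
      · rw [hψφ]
        exact h₄
      · have hψd : ψ ∈ d := by simpa [hψφ] using hψ
        have hψΔ : ψ ∈ Δ := Finset.mem_toList.1 (by simp [hd, hψd])
        rw [h₇ (tab ψ) ?_]
        · exact h₃ ψ hψd
        · simp only [ne_eq, Name.work.injEq, Nat.pair_eq_pair, true_and, not_and]
          intro e₁ e₂ e₃
          refine hψφ ?_
          have := hP.lhs_eq ψ hψΔ
          rw [e₂, ← hP.lhs_eq φ hφ] at this
          cases ψ; cases φ
          simp_all
  · rintro s ⟨h₁, h₂, h₃⟩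
    refine ⟨h₁, h₂, fun φ hφ h hh => ?_⟩
    obtain ⟨hz, hr, hx, hy⟩ := hat φ hφ
    have := h₃ φ (Finset.mem_toList.2 hφ) ((atomOf φ).1.args.map h)
      ((mem_iff_of_isListing hL).2 (by rw [← hr]; exact hP.isHom_iff.1 hh _ hz)) (fits_map _ _)
    rwa [read_map h hx, read_map h hy] at this

/-- The dependencies are tabulated, and every tuple is extended by lookups. Where a lookup finds
nothing, the tuple belongs to no homomorphism, and the appended values do not matter. -/
theorem reduction_to_ext (hP : Presents Q Δ Q' Z) :
    WeightPreservingExactReduction Q Δ Q' ∅ := by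
  have : Nonempty (Atom × List FD) := ⟨(⟨0, []⟩, [])⟩
  choose! atomOf hat using hP.on
  set P : Prog := .seq (fillTables Δ fun φ => (atomOf φ).1.args)
    (seqs (Z.map fun z => transfer z.1.rel z.1.args (seqs (z.2.map lookup))
      ((extArgs z).map val)))
  set T : Prog := seqs (Q.free.toList.map fun x => .move (.ansOut x) (.ansIn x))
  refine ⟨P, T, P.cost + T.cost, fun I hI hsat L hL => ?_⟩
  have hrun : Runs (I.size Q + 1) P (initState L) fun s =>
      ∃ (M : Name → ℕ → ℕ) (Lo : ℕ → List (List ℕ)),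
        (∀ φ ∈ Δ, ∀ h, Q.IsHom I h → M (tab φ) (h φ.src) = h φ.rhs) ∧
        (∀ S, HasOutput S (Lo S) s) ∧
        (∀ z ∈ Z, Lo z.1.rel = ((L z.1.rel).filter (Fits z.1.args ·)).map fun t =>
          (extArgs z).map (extend M z.2 (read z.1.args t))) ∧
        ∀ S ∉ Z.map (fun z => z.1.rel), Lo S = [] := by
    refine (hP.runs_fillTables hI hsat hL hat).seq ?_
    rintro s ⟨h₁, h₂, h₃⟩
    refine (runs_transfers (args := fun z => z.1.args) (L := L)
      (G := fun z h => (extArgs z).map (extend s.mem z.2 h))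
      hP.nodup ?_ ?_ ?_ ?_ h₁ ?_ (by omega) (fun z hz => hP.size_le hL hz) h₂ ?_).mono ?_
    · simp [lookup]
    · intro z _ x hx
      simp only [transferRegs] at hx
      simp only [mem_regs_seqs, List.mem_map, lookup]
      rintro ⟨_, ⟨φ, -, rfl⟩, rfl⟩
      simp at hx
    · intro z _
      ext A
      simp [lookup]
    · simp
    · exact fun z hz t ht => hP.length_eq hI hz ((mem_iff_of_isListing hL).1 ht)
    · intro z hz t ht hf s' hs' hval
      rw [List.map_map]
      refine List.map_congr_left fun v hv => ?_
      refine (eval_lookups (hP.derives z hz) _ s' hval v hv).trans ?_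
      rw [extend_congr_tables fun φ => hs' (tab φ) (by simp)]
    · rintro s' ⟨-, Lo, h₄, h₅, h₆⟩
      exact ⟨s.mem, Lo, h₃, h₄, h₅, h₆⟩
  obtain ⟨n, s, hexec, hn, M, Lo, hM, hout, hLo, hLo'⟩ := hrun
  have hmem : ∀ S t, t ∈ Lo S ↔ ∃ z ∈ Z, z.1.rel = S ∧ ∃ h : ℕ → ℕ, z.1.args.map h ∈ I S ∧
      t = (extArgs z).map (extend M z.2 h) := fun S t =>
    mem_transfer_iff (G := fun z h => (extArgs z).map (extend M z.2 h)) hL hLo hLo'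
      fun z hz h h' hh => List.map_congr_left (extend_congr (hP.derives z hz) hh)
  have hprefix : ∀ z ∈ Z, ∀ h : ℕ → ℕ, ∀ v ∈ z.1.args, extend M z.2 h v = h v :=
    fun z hz h v hv => extend_apply_of_mem (hP.derives z hz) h hv
  have hnd : ∀ S, (Lo S).Nodup := by
    refine nodup_transfer (G := fun z h => (extArgs z).map (extend M z.2 h)) hL hLo hLo' ?_
    intro z hz h h' _ _ he v hv
    rw [← hprefix z hz h v hv, ← hprefix z hz h' v hv]
    exact List.map_inj_left.1 he v (mem_extArgs hv)
  have hhom : ∀ h, Q'.IsHom (fun R => (Lo R).toFinset) h ↔ Q.IsHom I h := by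
    intro h
    rw [hP.isHom_ext_iff, hP.isHom_iff]
    simp only [List.mem_toFinset, hmem]
    constructor
    · intro H z hz
      obtain ⟨w, hw, hr, h', hh', he⟩ := H z hz
      obtain rfl := hP.eq_of_rel_eq hw hz hr
      have : w.1.args.map h = w.1.args.map h' := List.map_congr_left fun v hv => by
        rw [List.map_inj_left.1 he v (mem_extArgs hv), hprefix w hz h' v hv]
      rwa [this]
    · intro H z hz
      refine ⟨z, hz, rfl, h, H z hz, ?_⟩
      rw [extend_eq_self fun φ hφ =>
        hM φ ((hP.derives z hz).mem hφ) h (hP.isHom_iff.2 H)]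
  refine ⟨fun R => (Lo R).toFinset, n, s, fun q x => q ⟨x, hP.free_subset x.2⟩, ?_, ?_, hexec,
    hn.trans (Nat.mul_le_mul_right _ (Nat.le_add_right _ _)), outputs_of_hasOutput hout hnd, ?_,
    ?_, ?_⟩
  · intro R t ht
    obtain ⟨z, hz, rfl, h, -, rfl⟩ := (hmem R t).1 (List.mem_toFinset.1 ht)
    exact ⟨⟨z.1.rel, extArgs z⟩, by rw [hP.atoms_ext]; exact List.mem_map.2 ⟨z, hz, rfl⟩, rfl,
      by simp⟩
  · simp [Database.Satisfies]
  · refine ⟨?_, ?_, ?_⟩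
    · rintro q ⟨h, hh, hq⟩
      exact ⟨h, (hhom h).1 hh, fun x => hq _⟩
    · rintro q₁ ⟨h₁, hh₁, hq₁⟩ q₂ ⟨h₂, hh₂, hq₂⟩ he
      funext y
      obtain ⟨x, hx, hxy⟩ := hP.free_determined y y.2
      rw [hq₁, hq₂]
      refine hP.eq_of_determines hsat ((hhom _).1 hh₁) ((hhom _).1 hh₂) hxy ?_
      rw [← hq₁ ⟨x, hP.free_subset hx⟩, ← hq₂ ⟨x, hP.free_subset hx⟩]
      exact congrFun he ⟨x, hx⟩
    · rintro q ⟨h, hh, hq⟩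
      exact ⟨fun y => h y, ⟨h, (hhom h).2 hh, fun _ => rfl⟩, funext fun x => (hq x).symm⟩
  · intro q' _ s' hs' hin
    obtain ⟨m, s'', h₁, h₂, h₃⟩ := computesAnswer_seqs (Q := Q) (Q' := Q')
      (fun x => .move (.ansOut x) (.ansIn x)) (by simp) (by simp) (by simp) s.mem q'
      (fun x => q' ⟨x, hP.free_subset x.2⟩)
      (fun y s _ hs => by simpa [State.setReg_reg] using hs ⟨y, hP.free_subset y.2⟩) s' hs' hin
    exact ⟨m, s'', h₁, h₂.trans (Nat.le_add_left _ _), h₃⟩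
  · intro w
    refine ⟨fun y c => if y ∈ Q.free then w y c else 0, ?_⟩
    rintro q ⟨h, -, hq⟩
    rw [CQ.weight_eq_sum (Q := Q') hq,
      CQ.weight_eq_sum (Q := Q) (h := h) fun x => hq ⟨x, hP.free_subset x.2⟩]
    rw [← Finset.sum_subset hP.free_subset fun y _ hy => by simp [hy]]
    exact Finset.sum_congr rfl fun x hx => by simp [hx]

end Presents

/-! ### The reduction from the extension to the query -/

namespace RAM

/-- The code of an assignment of values to the variables in `l`, where `N y c` is the number of the
value `c` of the variable `y`. -/
def codeOf (N : ℕ → ℕ → ℕ) (l : List ℕ) (h : ℕ → ℕ) : ℕ := (l.map fun y => N y (h y)).sum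

theorem codeOf_congr {N N' : ℕ → ℕ → ℕ} {l : List ℕ} {h h' : ℕ → ℕ} (hN : ∀ y ∈ l, N y = N' y)
    (hh : ∀ y ∈ l, h y = h' y) : codeOf N l h = codeOf N' l h' := by
  rw [codeOf, codeOf, List.map_congr_left fun y hy => by rw [hN y hy, hh y hy]]

/-- Assignments of values from the sets `D y` to the variables of a sublist of `l` are determined by
their codes, which are less than `B`. -/
def Separates (N : ℕ → ℕ → ℕ) (D : ℕ → Set ℕ) (l : List ℕ) (B : ℕ) : Prop :=
  ∀ l' : List ℕ, l'.Sublist l → ∀ h h' : ℕ → ℕ, (∀ y ∈ l', h y ∈ D y) → (∀ y ∈ l', h' y ∈ D y) →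
    codeOf N l' h < B ∧ (codeOf N l' h = codeOf N l' h' → ∀ y ∈ l', h y = h' y)

/-- The values in `S` have as their numbers different multiples of `B`, all less than `c`, which is
itself a positive multiple of `B`. -/
def Numbered (N : ℕ → ℕ) (B : ℕ) (S : Set ℕ) (c : ℕ) : Prop :=
  ∃ (n : ℕ) (f : ℕ → ℕ), 1 ≤ n ∧ c = B * n ∧ (∀ a ∈ S, N a = B * f a ∧ f a < n) ∧ Set.InjOn f S

theorem Numbered.insert {N : ℕ → ℕ} {B : ℕ} {S : Set ℕ} {c : ℕ} (h : Numbered N B S c) (a : ℕ) :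
    Numbered (Function.update N a c) B (insert a S) (c + B) := by
  obtain ⟨n, f, hn, hc, hf, hinj⟩ := h
  refine ⟨n + 1, Function.update f a n, by omega, by rw [hc]; ring, ?_, ?_⟩
  · intro b hb
    by_cases hba : b = a
    · subst hba
      simp [hc]
    · obtain ⟨h₁, h₂⟩ := hf b (by simpa [hba] using hb)
      simp only [Function.update_of_ne hba]
      exact ⟨h₁, by omega⟩
  · intro b hb b' hb' he
    by_cases hba : b = a <;> by_cases hba' : b' = a
    · rw [hba, hba']
    · rw [hba, Function.update_self, Function.update_of_ne hba'] at he
      have := (hf b' (by simpa [hba'] using hb')).2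
      omega
    · rw [hba', Function.update_self, Function.update_of_ne hba] at he
      have := (hf b (by simpa [hba] using hb)).2
      omega
    · rw [Function.update_of_ne hba, Function.update_of_ne hba'] at he
      exact hinj (by simpa [hba] using hb) (by simpa [hba'] using hb') he

theorem Numbered.mono {N : ℕ → ℕ} {B : ℕ} {S S' : Set ℕ} {c : ℕ} (h : Numbered N B S c)
    (hS : S' ⊆ S) : Numbered N B S' c := by
  obtain ⟨n, f, hn, hc, hf, hinj⟩ := h
  exact ⟨n, f, hn, hc, fun a ha => hf a (hS ha), hinj.mono hS⟩

theorem Separates.snoc {N N' : ℕ → ℕ → ℕ} {D : ℕ → Set ℕ} {l : List ℕ} {B C y : ℕ}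
    (h : Separates N D l B) (hN : ∀ x ∈ l, N' x = N x) (hy : Numbered (N' y) B (D y) C) :
    Separates N' D (l ++ [y]) C := by
  obtain ⟨n, f, hn, rfl, hf, hinj⟩ := hy
  intro l' hl' g g' hg hg'
  obtain ⟨l₁, l₂, rfl, h₁, h₂⟩ := List.sublist_append_iff.1 hl'
  have hcode : ∀ g, codeOf N' l₁ g = codeOf N l₁ g := fun g =>
    codeOf_congr (fun x hx => hN x (h₁.subset hx)) fun _ _ => rfl
  obtain ⟨h₃, h₄⟩ := h l₁ h₁ g g' (fun x hx => hg x (by simp [hx])) fun x hx => hg' x (by simp [hx])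
  obtain ⟨h₅, -⟩ := h l₁ h₁ g' g (fun x hx => hg' x (by simp [hx])) fun x hx => hg x (by simp [hx])
  have happ : ∀ g, codeOf N' (l₁ ++ l₂) g = codeOf N l₁ g + codeOf N' l₂ g := fun g => by
    rw [← hcode g]
    simp [codeOf]
  rw [happ, happ]
  rcases List.sublist_singleton.1 h₂ with rfl | rfl
  · refine ⟨?_, ?_⟩
    · simp only [codeOf, List.map_nil, List.sum_nil, add_zero] at h₃ ⊢
      exact h₃.trans_le (Nat.le_mul_of_pos_right _ hn)
    · simpa [codeOf] using h₄
  · obtain ⟨h₆, h₇⟩ := hf (g y) (hg y (by simp))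
    obtain ⟨h₈, h₉⟩ := hf (g' y) (hg' y (by simp))
    have hs : ∀ g, codeOf N' [y] g = N' y (g y) := fun g => by simp [codeOf]
    rw [hs, hs, h₆, h₈]
    refine ⟨?_, ?_⟩
    · have : B * (f (g y) + 1) ≤ B * n := Nat.mul_le_mul_left _ h₇
      rw [mul_add] at this
      omega
    · intro he
      have hB : 0 < B := by omega
      -- Quotient and remainder by `B` separate the last variable from the others.
      have hq : f (g y) = f (g' y) := by
        have := congrArg (· / B) he
        simpa [Nat.add_mul_div_left _ _ hB, Nat.div_eq_of_lt h₃, Nat.div_eq_of_lt h₅] using this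
      have hr : codeOf N l₁ g = codeOf N l₁ g' := by
        rw [hq] at he
        omega
      intro x hx
      rcases List.mem_append.1 hx with hx | hx
      · exact h₄ hr x hx
      · obtain rfl : x = y := by simpa using hx
        exact hinj (hg x (by simp)) (hg' x (by simp)) hq

/-- The array of the numbers of the values of the variable `y`. -/
abbrev num (y : ℕ) : Name := .work (Nat.pair 3 y)

/-- The array that recovers the value of the variable `y` from a code. -/
abbrev dec (y : ℕ) : Name := .work (Nat.pair 4 y)

/-- The register for the code of the variable `x`. -/
abbrev code (x : ℕ) : Name := .work (Nat.pair 5 x)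

/-- The next number to be given to a value. -/
abbrev cnt : Name := .work (Nat.pair 1 6)

/-- The distance between consecutive numbers. -/
abbrev step : Name := .work (Nat.pair 1 7)

/-- The values of the variable `y` in the consistent tuples of the relations in `Z`. -/
def values (L : ℕ → List (List ℕ)) (Z : List (Atom × List FD)) (y : ℕ) : Set ℕ :=
  {c | ∃ z ∈ Z, y ∈ extArgs z ∧ ∃ t ∈ L z.1.rel, Fits (extArgs z) t ∧ read (extArgs z) t y = c}

/-- Number the occurrences of values of `y` in the relation of one atom. A value with several
occurrences keeps the last number. -/
def numberIn (y : ℕ) (z : Atom × List FD) : Prog :=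
  forTuples z.1.rel (extArgs z) (.seq (.store (num y) (val y) cnt) (.add cnt cnt step))

/-- Number all values of `y`, and let the next variable use multiples of the final count. Counting
starts at `step`, not at zero, so that the radix stays positive if `y` has no values. -/
def numberVar (Z : List (Atom × List FD)) (y : ℕ) : Prog :=
  .seq (.move cnt step)
    (.seq (seqs ((Z.filter (y ∈ extArgs ·)).map (numberIn y))) (.move step cnt))

theorem runs_numberIn {M y B : ℕ} {z : Atom × List FD} {L : ℕ → List (List ℕ)} {s₀ : State}
    {S : Set ℕ} (hy : y ∈ extArgs z) (hin : HasInput L s₀)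
    (hlen : ∀ t ∈ L z.1.rel, t.length = (extArgs z).length) (hM : (L z.1.rel).length + 1 ≤ M)
    (hstep : s₀.reg step = B) (hS : Numbered (s₀.mem (num y)) B S (s₀.reg cnt)) :
    Runs M (numberIn y z) s₀ fun s => Numbered (s.mem (num y)) B
      (S ∪ {c | ∃ t ∈ L z.1.rel, Fits (extArgs z) t ∧ read (extArgs z) t y = c}) (s.reg cnt) := by
  refine (runs_forTuples (L := L z.1.rel) (R := z.1.rel)
    (Inv := fun d s => Numbered (s.mem (num y)) B
      (S ∪ {c | ∃ t ∈ d, Fits (extArgs z) t ∧ read (extArgs z) t y = c}) (s.reg cnt))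
    (by simp) (by simp) (by simp) (hin _).1 (hin _).2 hlen hM ?_ ?_ ?_ ?_)
  · intro d s s' h hm hr
    rw [hm, hr _ (by simp [loopRegs])]
    exact h
  · simpa using hS
  · intro d t s ht h
    refine h.mono (Set.union_subset_union_right _ ?_)
    rintro c ⟨t', ht', hf, hc⟩
    rcases List.mem_append.1 ht' with h' | h'
    · exact ⟨t', h', hf, hc⟩
    · obtain rfl : t' = t := by simpa using h'
      exact absurd hf ht
  · intro d t r s _ ht h hval _ _ hr
    have hst : s.reg step = B := by rw [hr _ (by simp [loopRegs]), hstep]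
    have := h.insert (read (extArgs z) t y)
    simp only [Prog.eval, State.setReg_mem, State.setReg_reg, hst, hval y hy,
      State.setMem, Function.update_self, if_true]
    refine this.mono ?_
    rintro c (hc | ⟨t', ht', hf, hc⟩)
    · exact Or.inr (Or.inl hc)
    · rcases List.mem_append.1 ht' with h' | h'
      · exact Or.inr (Or.inr ⟨t', h', hf, hc⟩)
      · obtain rfl : t' = t := by simpa using h'
        exact Or.inl hc.symm

theorem regs_numberIn (y : ℕ) (z : Atom × List FD) :
    (numberIn y z).regs ⊆ {cnt} ∪ loopRegs := by
  simpa [numberIn] using regs_forTuples z.1.rel (extArgs z)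
    (.seq (.store (num y) (val y) cnt) (.add cnt cnt step))

theorem arrs_numberIn (y : ℕ) (z : Atom × List FD) : (numberIn y z).arrs ⊆ {num y} := by
  simpa [numberIn] using arrs_forTuples z.1.rel (extArgs z)
    (.seq (.store (num y) (val y) cnt) (.add cnt cnt step))

theorem runs_numberVar {M y : ℕ} {Z : List (Atom × List FD)} {L : ℕ → List (List ℕ)}
    {s₀ : State} (hin : HasInput L s₀)
    (hlen : ∀ z ∈ Z, ∀ t ∈ L z.1.rel, t.length = (extArgs z).length) (hM1 : 1 ≤ M)
    (hM : ∀ z ∈ Z, (L z.1.rel).length + 1 ≤ M) :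
    Runs M (numberVar Z y) s₀ fun s => HasInput L s ∧ (∀ S, s.reg (.out S) = s₀.reg (.out S)) ∧
      (∀ A, A ≠ num y → s.mem A = s₀.mem A) ∧
      Numbered (s.mem (num y)) (s₀.reg step) (values L Z y) (s.reg step) := by
  have key : Runs M (numberVar Z y) s₀ fun s =>
      Numbered (s.mem (num y)) (s₀.reg step) (values L Z y) (s.reg step) := by
    refine Runs.seq (P := fun s => s = s₀.setReg cnt (s₀.reg step))
      (runs_eval hM1 (p := .move cnt step) trivial rfl) ?_
    rintro _ rfl
    refine Runs.seq (runs_seqs hM1 _ _ (fun d s => HasInput L s ∧ s.reg step = s₀.reg step ∧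
      Numbered (s.mem (num y)) (s₀.reg step) (values L d y) (s.reg cnt)) _ ?_ ?_) ?_
    · refine ⟨hin, by simp [State.setReg_reg], 1, fun _ => 0, le_rfl, ?_, ?_, ?_⟩
      · simp [State.setReg_reg]
      · simp [values]
      · simp [values, Set.InjOn]
    · rintro d z r s hd ⟨h₁, h₂, h₃⟩
      obtain ⟨hz, hy⟩ := List.mem_filter.1 (show z ∈ Z.filter (y ∈ extArgs ·) by simp [hd])
      have hy : y ∈ extArgs z := of_decide_eq_true hy
      refine (runs_numberIn hy h₁ (hlen z hz) (hM z hz) h₂ h₃).frame.mono ?_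
      rintro s' ⟨h₄, h₅, h₆⟩
      refine ⟨h₁.congr (fun S => h₅ _ fun h => ?_) (fun S => h₆ _ fun h => ?_), ?_, h₄.mono ?_⟩
      · rcases regs_numberIn y z h with h | h
        · simp at h
        · simp [loopRegs] at h
      · simpa using arrs_numberIn y z h
      · rw [h₅ _ fun h => ?_, h₂]
        rcases regs_numberIn y z h with h | h
        · simp at h
        · simp [loopRegs] at h
      · rintro c ⟨w, hw, hyw, t, ht, hf, hc⟩
        rcases List.mem_append.1 hw with hw | hw
        · exact Or.inl ⟨w, hw, hyw, t, ht, hf, hc⟩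
        · obtain rfl : w = z := by simpa using hw
          exact Or.inr ⟨t, ht, hf, hc⟩
    · rintro s ⟨-, -, h⟩
      refine runs_eval hM1 (p := .move step cnt) trivial ?_
      simp only [Prog.eval, State.setReg_mem, State.setReg_reg, if_true]
      refine h.mono ?_
      rintro c ⟨z, hz, hy, t, ht, hf, hc⟩
      exact ⟨z, List.mem_filter.2 ⟨hz, decide_eq_true hy⟩, hy, t, ht, hf, hc⟩
  refine key.frame.mono ?_
  rintro s ⟨h₁, h₂, h₃⟩
  have hr : ∀ x, x ≠ cnt → x ≠ step → x ∉ loopRegs → s.reg x = s₀.reg x := by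
    refine fun x hx hx' hx'' => h₂ x ?_
    rintro (h | h | h)
    · exact hx h
    · obtain ⟨p, hp, h⟩ := mem_regs_seqs.1 h
      obtain ⟨z, -, rfl⟩ := List.mem_map.1 hp
      rcases regs_numberIn y z h with h | h
      · exact hx h
      · exact hx'' h
    · exact hx' h
  have hm : ∀ A, A ≠ num y → s.mem A = s₀.mem A := by
    refine fun A hA => h₃ A ?_
    rintro (h | h | h)
    · exact h
    · obtain ⟨p, hp, h⟩ := mem_arrs_seqs.1 h
      obtain ⟨z, -, rfl⟩ := List.mem_map.1 hp
      exact hA (arrs_numberIn y z h)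
    · exact h
  exact ⟨hin.congr (fun S => hr _ (by simp) (by simp) (by simp [loopRegs])) fun S => hm _ (by simp),
    fun S => hr _ (by simp) (by simp) (by simp [loopRegs]), hm, h₁⟩

/-- After all variables have been numbered, sums of numbers determine their summands. -/
theorem runs_numberVars {M : ℕ} {Z : List (Atom × List FD)} {V : List ℕ} {L : ℕ → List (List ℕ)}
    (hV : V.Nodup) (hlen : ∀ z ∈ Z, ∀ t ∈ L z.1.rel, t.length = (extArgs z).length) (hM1 : 1 ≤ M)
    (hM : ∀ z ∈ Z, (L z.1.rel).length + 1 ≤ M) :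
    Runs M (.seq (.const step 1) (seqs (V.map (numberVar Z)))) (initState L) fun s =>
      HasInput L s ∧ (∀ S, s.reg (.out S) = 0) ∧
      ∃ B, Separates (fun y => s.mem (num y)) (values L Z) V B := by
  refine Runs.seq (P := fun s => s = (initState L).setReg step 1)
    (runs_eval hM1 (p := .const step 1) trivial rfl) ?_
  rintro _ rfl
  refine (runs_seqs hM1 _ V (fun d s => HasInput L s ∧ (∀ S, s.reg (.out S) = 0) ∧
    Separates (fun y => s.mem (num y)) (values L Z) d (s.reg step)) _ ?_ ?_).mono
    fun s h => ⟨h.1, h.2.1, _, h.2.2⟩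
  · refine ⟨(hasInput_initState L).congr (fun S => by simp [State.setReg_reg]) fun _ => rfl,
      fun S => by simp [State.setReg_reg, initState], ?_⟩
    intro l' hl' h h' _ _
    obtain rfl := List.sublist_nil.1 hl'
    simp [codeOf, State.setReg_reg]
  · rintro d y r s hd ⟨h₁, h₂, h₃⟩
    refine (runs_numberVar h₁ hlen hM1 hM).mono ?_
    rintro s' ⟨h₄, h₅, h₆, h₇⟩
    refine ⟨h₄, fun S => (h₅ S).trans (h₂ S), h₃.snoc (fun x hx => h₆ _ ?_) h₇⟩
    rw [hd, List.nodup_append] at hV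
    have : x ≠ y := fun h => hV.2.2 _ hx _ (by simp) h
    simpa using this

/-- Compute the code of `x`, a sum over the variables in `l`. -/
def codeProg (l : List ℕ) (x : ℕ) : Prog :=
  .seq (.const (code x) 0)
    (seqs (l.map fun y => .seq (.load tmp (num y) (val y)) (.add (code x) (code x) tmp)))

theorem loopFree_codeProg (l : List ℕ) (x : ℕ) : (codeProg l x).LoopFree := by
  simp [codeProg]

theorem regs_codeProg (l : List ℕ) (x : ℕ) : (codeProg l x).regs ⊆ {code x, tmp} := by
  rintro r (h | h)
  · exact Or.inl h
  · obtain ⟨p, hp, h⟩ := mem_regs_seqs.1 h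
    obtain ⟨y, -, rfl⟩ := List.mem_map.1 hp
    simpa [or_comm] using h

theorem arrs_codeProg (l : List ℕ) (x : ℕ) : (codeProg l x).arrs = ∅ := by
  ext A
  simp [codeProg]

theorem disjoint_regs_codeProg (l : List ℕ) (x : ℕ) : ∀ r ∈ transferRegs,
    r ∉ (codeProg l x).regs := by
  intro r hr h
  rcases regs_codeProg l x h with rfl | rfl <;> simp [transferRegs] at hr

theorem eval_codeProg (l : List ℕ) (x : ℕ) (h : ℕ → ℕ) (s : State)
    (hs : ∀ y ∈ l, s.reg (val y) = h y) :
    ((codeProg l x).eval s).reg (code x) = codeOf (fun y => s.mem (num y)) l h := by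
  have key : ∀ (l : List ℕ) (s : State), (∀ y ∈ l, s.reg (val y) = h y) →
      ((seqs (l.map fun y => .seq (.load tmp (num y) (val y))
        (.add (code x) (code x) tmp))).eval s).reg (code x) =
      s.reg (code x) + codeOf (fun y => s.mem (num y)) l h := by
    intro l
    induction l with
    | nil => simp [codeOf]
    | cons y l ih =>
      intro s hs
      simp only [List.map_cons, seqs_cons, Prog.eval]
      rw [ih _ fun y hy => by simpa [State.setReg_reg] using hs y (by simp [hy])]
      simp [State.setReg_reg, codeOf, hs y, Nat.add_assoc]
  simp only [codeProg, Prog.eval]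
  rw [key l _ fun y hy => by simpa [State.setReg_reg] using hs y hy]
  simp [State.setReg_reg]

theorem eval_codeProgs (cl : ℕ → List ℕ) (xs : List ℕ) (h : ℕ → ℕ) (s : State)
    (hs : ∀ x ∈ xs, ∀ y ∈ cl x, s.reg (val y) = h y) (x : ℕ)
    (hx : s.reg (code x) = codeOf (fun y => s.mem (num y)) (cl x) h ∨ x ∈ xs) :
    ((seqs (xs.map fun x => codeProg (cl x) x)).eval s).reg (code x) =
      codeOf (fun y => s.mem (num y)) (cl x) h := by
  induction xs generalizing s with
  | nil => simpa using hx
  | cons w xs ih =>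
    simp only [List.map_cons, seqs_cons, Prog.eval]
    have hm : ((codeProg (cl w) w).eval s).mem = s.mem := funext fun A =>
      eval_mem_eq (loopFree_codeProg _ _) s (by simp [arrs_codeProg])
    have hr : ∀ r, r ≠ code w → r ≠ tmp → ((codeProg (cl w) w).eval s).reg r = s.reg r := by
      refine fun r h₁ h₂ => eval_reg_eq (loopFree_codeProg _ _) s fun h => ?_
      rcases regs_codeProg _ _ h with h | h
      · exact h₁ h
      · exact h₂ h
    have := ih ((codeProg (cl w) w).eval s) (fun x hx y hy => by
      rw [hr _ (by simp) (by simp)]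
      exact hs x (by simp [hx]) y hy) (by
      rw [hm]
      by_cases hxw : x = w
      · subst hxw
        exact Or.inl (eval_codeProg _ _ _ _ (hs x (by simp)))
      · rw [hr _ (by simpa using hxw) (by simp)]
        exact hx.imp_right fun h => by simpa [hxw] using h)
    rwa [hm] at this

end RAM

/-- The function `c` codes assignments: `c x h` depends on the values that `h` gives to the variables
determined by `x`, and for assignments that come from tuples of `I` it determines these values. -/
structure IsCoding (Δ : Finset FD) (Z : List (Atom × List FD)) (I : Database)
    (c : ℕ → (ℕ → ℕ) → ℕ) : Prop where
  congr : ∀ (x : ℕ) (h h' : ℕ → ℕ), (∀ y, Determines Δ x y → h y = h' y) → c x h = c x h'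
  inj : ∀ z ∈ Z, ∀ z' ∈ Z, ∀ (x : ℕ) (h h' : ℕ → ℕ), x ∈ extArgs z → x ∈ extArgs z' →
    (extArgs z).map h ∈ I z.1.rel → (extArgs z').map h' ∈ I z'.1.rel → c x h = c x h' →
    ∀ y, Determines Δ x y → h y = h' y

/-- The relations of `J` are made of the codes of the assignments that come from tuples of `I`. -/
def IsCoded (Z : List (Atom × List FD)) (I J : Database) (c : ℕ → (ℕ → ℕ) → ℕ) : Prop :=
  ∀ R t, t ∈ J R ↔ ∃ z ∈ Z, z.1.rel = R ∧ ∃ h : ℕ → ℕ, (extArgs z).map h ∈ I R ∧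
    t = z.1.args.map fun x => c x h

namespace Presents

open RAM

variable {Q Q' : CQ} {Δ : Finset FD} {Z : List (Atom × List FD)} {I J : Database}
  {c : ℕ → (ℕ → ℕ) → ℕ}

theorem over_of_isCoded (hP : Presents Q Δ Q' Z) (hJ : IsCoded Z I J c) : J.Over Q := by
  intro R t ht
  obtain ⟨z, hz, rfl, h, -, rfl⟩ := (hJ R t).1 ht
  exact ⟨z.1, by rw [hP.atoms]; exact List.mem_map_of_mem hz, rfl, by simp⟩

/-- The code of `x` contains the value of `y`, and all that `y` determines, if `x` determines
`y`. -/
theorem satisfies_of_isCoded (hP : Presents Q Δ Q' Z) (hc : IsCoding Δ Z I c)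
    (hJ : IsCoded Z I J c) : J.Satisfies Q Δ := by
  intro φ hφ a ha hr t₁ ht₁ t₂ ht₂ hX d₁ d₂ hd₁ hd₂
  obtain ⟨z, hz, hzr, hx, hy⟩ := hP.on φ hφ
  obtain ⟨z₁, hz₁, hr₁, h₁, hh₁, rfl⟩ := (hJ _ _).1 ht₁
  obtain ⟨z₂, hz₂, hr₂, h₂, hh₂, rfl⟩ := (hJ _ _).1 ht₂
  rw [hP.atoms] at ha
  obtain ⟨w, hw, rfl⟩ := List.mem_map.1 ha
  obtain rfl := hP.eq_of_rel_eq hw hz (hr.trans hzr.symm)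
  obtain rfl := hP.eq_of_rel_eq hz₁ hz (hr₁.trans hzr.symm)
  obtain rfl := hP.eq_of_rel_eq hz₂ hz (hr₂.trans hzr.symm)
  rw [← hr] at hh₁ hh₂
  obtain ⟨e, he₁, he₂⟩ := hX φ.src (by simp [hP.lhs_eq φ hφ])
  rw [assigns_map hx] at he₁ he₂
  rw [assigns_map hy] at hd₁ hd₂
  rw [← hd₁, ← hd₂]
  refine hc.congr _ _ _ fun y hy => ?_
  exact hc.inj _ hz _ hz φ.src h₁ h₂ (mem_extArgs hx) (mem_extArgs hx) hh₁ hh₂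
    (he₁.trans he₂.symm) y (.head ⟨φ, hφ, rfl, rfl⟩ hy)

theorem isHom_of_isCoded (hP : Presents Q Δ Q' Z) (hJ : IsCoded Z I J c) {h : ℕ → ℕ}
    (hh : Q'.IsHom I h) : Q.IsHom J fun x => c x h := by
  rw [hP.isHom_iff]
  intro z hz
  exact (hJ _ _).2 ⟨z, hz, rfl, h, hP.isHom_ext_iff.1 hh z hz, rfl⟩

/-- Every homomorphism to the coded database codes a homomorphism of the extension. The tuples that
it selects in the different relations agree on common variables: if `x` determines `y` by
the dependency `φ`, then the atom of `φ` contains both, so that the value of `y` that is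
part of the code of `x` agrees with the code of `y`. -/
theorem exists_isHom_of_isCoded (hP : Presents Q Δ Q' Z) (hc : IsCoding Δ Z I c)
    (hJ : IsCoded Z I J c) {g : ℕ → ℕ} (hg : Q.IsHom J g) :
    ∃ h, Q'.IsHom I h ∧ ∀ z ∈ Z, ∀ x ∈ z.1.args, g x = c x h := by
  have hloc : ∀ z ∈ Z, ∃ h : ℕ → ℕ, (extArgs z).map h ∈ I z.1.rel ∧
      ∀ x ∈ z.1.args, g x = c x h := by
    intro z hz
    obtain ⟨w, hw, hr, h, hh, he⟩ := (hJ _ _).1 (hP.isHom_iff.1 hg z hz)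
    obtain rfl := hP.eq_of_rel_eq hw hz hr
    exact ⟨h, hh, List.map_inj_left.1 he⟩
  choose! hom hI hcode using hloc
  have hall : ∀ z ∈ Z, ∀ y ∈ extArgs z, g y = c y (hom z) := by
    intro z hz y hy
    obtain ⟨x, hx, hxy⟩ := (hP.derives z hz).exists_determines hy
    clear hy
    induction hxy with
    | refl => exact hcode z hz x hx
    | tail hxw hφ ih =>
      obtain ⟨φ, hφ, rfl, rfl⟩ := hφ
      obtain ⟨w, hw, -, hwx, hwy⟩ := hP.on φ hφ
      have hsrc := hP.mem_extArgs_of_determines hz hxw (mem_extArgs hx)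
      rw [hcode w hw _ hwy]
      refine hc.congr _ _ _ fun v hv => ?_
      exact hc.inj w hw z hz φ.src _ _ (mem_extArgs hwx) hsrc (hI w hw) (hI z hz)
        ((hcode w hw _ hwx).symm.trans ih) v (.head ⟨φ, hφ, rfl, rfl⟩ hv)
  classical
  let h : ℕ → ℕ := fun y => if hy : ∃ z ∈ Z, y ∈ extArgs z then hom hy.choose y else 0
  have hh : ∀ z ∈ Z, ∀ y ∈ extArgs z, h y = hom z y := by
    intro z hz y hy
    have hy' : ∃ z ∈ Z, y ∈ extArgs z := ⟨z, hz, hy⟩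
    obtain ⟨hw, hyw⟩ := hy'.choose_spec
    rw [show h y = hom hy'.choose y from dif_pos hy']
    exact hc.inj _ hw z hz y _ _ hyw hy (hI _ hw) (hI z hz)
      ((hall _ hw y hyw).symm.trans (hall z hz y hy)) y .refl
  refine ⟨h, hP.isHom_ext_iff.2 fun z hz => ?_, fun z hz x hx => ?_⟩
  · rw [List.map_congr_left (hh z hz)]
    exact hI z hz
  · rw [hcode z hz x hx]
    exact hc.congr _ _ _ fun y hy =>
      (hh z hz y (hP.mem_extArgs_of_determines hz hy (mem_extArgs hx))).symm

/-- Every value is replaced by a code of the values of all variables that its variable determines.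
The numbering of the values makes room for the codes, and the tables that decode them are filled
while the input is at hand. -/
theorem reduction_from_ext (hP : Presents Q Δ Q' Z) :
    WeightPreservingExactReduction Q' ∅ Q Δ := by
  classical
  -- A free variable of `Q` that determines the given free variable of `Q'`, and its atom.
  have hsrc : ∀ y ∈ Q'.free, ∃ (x : ℕ) (z : Atom × List FD), x ∈ Q.free ∧ Determines Δ x y ∧
      z ∈ Z ∧ x ∈ z.1.args := by
    intro y hy
    obtain ⟨x, hx, hxy⟩ := hP.free_determined y hy
    obtain ⟨z, hz, hxz⟩ := hP.safe x hx
    exact ⟨x, z, hx, hxy, hz, hxz⟩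
  have : Nonempty (Atom × List FD) := ⟨(⟨0, []⟩, [])⟩
  choose! src atomOf hfree hdet hat hsrcat using hsrc
  let V : List ℕ := (Z.flatMap extArgs).dedup
  have hV : V.Nodup := List.nodup_dedup _
  have hmemV : ∀ z ∈ Z, ∀ y ∈ extArgs z, y ∈ V := fun z hz y hy =>
    List.mem_dedup.2 (List.mem_flatMap.2 ⟨z, hz, hy⟩)
  let cl : ℕ → List ℕ := fun x => V.filter (Determines Δ x ·)
  have hcl : ∀ z ∈ Z, ∀ x ∈ extArgs z, ∀ y, Determines Δ x y → y ∈ extArgs z ∧ y ∈ cl x :=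
    fun z hz x hx y hxy => by
      have := hP.mem_extArgs_of_determines hz hxy hx
      exact ⟨this, List.mem_filter.2 ⟨hmemV z hz y this, decide_eq_true hxy⟩⟩
  have hcl' : ∀ x, ∀ y ∈ cl x, Determines Δ x y := fun x y hy =>
    of_decide_eq_true (List.mem_filter.1 hy).2
  have hclsub : ∀ z ∈ Z, ∀ x ∈ extArgs z, ∀ y ∈ cl x, y ∈ extArgs z := fun z hz x hx y hy =>
    (hcl z hz x hx y (hcl' x y hy)).1
  set P : Prog := .seq (.seq (.const step 1) (seqs (V.map (numberVar Z))))
    (.seq (seqs (Q'.free.toList.map fun y => fill (atomOf y).1.rel (extArgs (atomOf y))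
        (codeProg (cl (src y)) (src y)) (dec y) (code (src y)) (val y)))
      (seqs (Z.map fun z => transfer z.1.rel (extArgs z)
        (seqs (z.1.args.map fun x => codeProg (cl x) x)) (z.1.args.map code))))
  set T : Prog := seqs (Q'.free.toList.map fun y => .load (.ansOut y) (dec y) (.ansIn (src y)))
   
  refine ⟨P, T, P.cost + T.cost, fun I hI _ L hL => ?_⟩
  rw [hP.size_ext]
  have hlen : ∀ z ∈ Z, ∀ t ∈ L z.1.rel, t.length = (extArgs z).length := fun z hz t ht =>
    hP.length_eq_ext hI hz ((mem_iff_of_isListing hL).1 ht)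
  have hM : ∀ z ∈ Z, (L z.1.rel).length + 1 ≤ I.size Q + 1 := fun z hz => hP.size_le hL hz
  have hinj : ∀ (N : ℕ → ℕ → ℕ) (B : ℕ), Separates N (values L Z) V B →
      IsCoding Δ Z I fun x => codeOf N (cl x) := by
    intro N B hN
    refine ⟨fun x h h' hh => codeOf_congr (fun _ _ => rfl) fun y hy => hh y (hcl' x y hy), ?_⟩
    intro z hz z' hz' x h h' hx hx' hh hh' he y hxy
    have hval : ∀ z ∈ Z, ∀ h : ℕ → ℕ, x ∈ extArgs z → (extArgs z).map h ∈ I z.1.rel →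
        ∀ y ∈ cl x, h y ∈ values L Z y := fun z hz h hx hh y hy =>
      ⟨z, hz, hclsub z hz x hx y hy, _, (mem_iff_of_isListing hL).2 hh, fits_map _ _,
        read_map h (hclsub z hz x hx y hy)⟩
    exact (hN (cl x) List.filter_sublist h h' (hval z hz h hx hh) (hval z' hz' h' hx' hh')).2 he y
      (hcl z hz x hx y hxy).2
  have hrun : Runs (I.size Q + 1) P (initState L) fun s =>
      ∃ (N : ℕ → ℕ → ℕ) (Lo : ℕ → List (List ℕ)), IsCoding Δ Z I (fun x => codeOf N (cl x)) ∧
        (∀ S, HasOutput S (Lo S) s) ∧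
        (∀ z ∈ Z, Lo z.1.rel = ((L z.1.rel).filter (Fits (extArgs z) ·)).map fun t =>
          z.1.args.map fun x => codeOf N (cl x) (RAM.read (extArgs z) t)) ∧
        (∀ S ∉ Z.map (fun z => z.1.rel), Lo S = []) ∧
        ∀ y ∈ Q'.free, ∀ h, Q'.IsHom I h → s.mem (dec y) (codeOf N (cl (src y)) h) = h y := by
    refine (runs_numberVars hV hlen (by omega) hM).seq ?_
    rintro s₁ ⟨h₁, h₂, B, hN⟩
    have hcoding := hinj _ B hN
    refine Runs.seq (runs_seqs (by omega) _ Q'.free.toList (fun d s => HasInput L s ∧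
      (∀ S, s.reg (.out S) = 0) ∧ (∀ y, s.mem (num y) = s₁.mem (num y)) ∧
      ∀ y ∈ d, ∀ t ∈ L (atomOf y).1.rel, Fits (extArgs (atomOf y)) t →
        s.mem (dec y) (codeOf (fun y => s₁.mem (num y)) (cl (src y))
          (RAM.read (extArgs (atomOf y)) t)) = RAM.read (extArgs (atomOf y)) t y) s₁
      ⟨h₁, h₂, fun _ => rfl, by simp⟩ ?_) ?_
    · rintro d y r s hd ⟨h₃, h₄, h₅, h₆⟩
      have hyf : y ∈ Q'.free := Finset.mem_toList.1 (by simp [hd])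
      have hz := hat y hyf
      have hx : src y ∈ extArgs (atomOf y) := mem_extArgs (hsrcat y hyf)
      have hy : y ∈ extArgs (atomOf y) := (hcl _ hz _ hx y (hdet y hyf)).1
      refine (runs_fill (L := L) (M := I.size Q + 1)
        (K := fun t => codeOf (fun y => s₁.mem (num y)) (cl (src y))
          (RAM.read (extArgs (atomOf y)) t))
        (V := fun t => RAM.read (extArgs (atomOf y)) t y) (loopFree_codeProg _ _)
        (disjoint_regs_codeProg _ _) (arrs_codeProg _ _) (by simp) h₃ (hlen _ hz) (hM _ hz)
        ?_ ?_).mono ?_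
      · intro t ht hf s' hs' hval
        refine ⟨?_, ?_⟩
        · rw [eval_codeProg _ _ (RAM.read (extArgs (atomOf y)) t) _
            fun v hv => hval v (hclsub _ hz _ hx v hv)]
          exact codeOf_congr (fun v _ => (hs' _ (by simp)).trans (h₅ v)) fun _ _ => rfl
        · rw [eval_reg_eq (loopFree_codeProg _ _), hval y hy]
          intro h
          rcases regs_codeProg _ _ h with h | h <;> simp at h
      · intro t ht t' ht' hf hf' hK
        refine hcoding.inj _ hz _ hz (src y) _ _ hx hx ?_ ?_ hK y (hdet y hyf)
        · rw [hf]; exact (mem_iff_of_isListing hL).1 ht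
        · rw [hf']; exact (mem_iff_of_isListing hL).1 ht'
      · rintro s' ⟨h₇, h₈, h₉, h₁₀⟩
        refine ⟨h₈, fun S => (h₉ S).trans (h₄ S),
          fun v => (h₁₀ _ (by simp)).trans (h₅ v), fun v hv => ?_⟩
        by_cases hvy : v = y
        · rw [hvy]
          exact h₇
        · rw [h₁₀ _ (by simpa using hvy)]
          exact h₆ v (by simpa [hvy] using hv)
    · rintro s₂ ⟨h₃, h₄, h₅, h₆⟩
      refine (runs_transfers (args := extArgs) (L := L)
        (G := fun z h => z.1.args.map fun x => codeOf (fun y => s₁.mem (num y)) (cl x) h)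
        hP.nodup ?_ ?_ ?_ ?_ h₃ hlen (by omega) hM h₄ ?_).mono ?_
      · simp [loopFree_codeProg]
      · intro z _ r hr h
        obtain ⟨p, hp, h⟩ := mem_regs_seqs.1 h
        obtain ⟨x, -, rfl⟩ := List.mem_map.1 hp
        exact disjoint_regs_codeProg _ _ r hr h
      · intro z _
        ext A
        simp [arrs_codeProg]
      · simp
      · intro z hz t ht hf s hs hval
        rw [List.map_map]
        refine List.map_congr_left fun x hx => ?_
        refine (eval_codeProgs cl z.1.args (RAM.read (extArgs z) t) s (fun x hx y hy =>
          hval y (hclsub z hz x (mem_extArgs hx) y hy)) x (Or.inr hx)).trans ?_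
        exact codeOf_congr (fun y _ => (hs _ (by simp)).trans (h₅ y)) fun _ _ => rfl
      · rintro s ⟨hs, Lo, h₇, h₈, h₉⟩
        refine ⟨_, Lo, hcoding, h₇, h₈, h₉, fun y hy h hh => ?_⟩
        have hz := hat y hy
        have hx : src y ∈ extArgs (atomOf y) := mem_extArgs (hsrcat y hy)
        have := h₆ y (Finset.mem_toList.2 hy) _
          ((mem_iff_of_isListing hL).2 (hP.isHom_ext_iff.1 hh _ hz)) (fits_map _ _)
        rw [read_map h (hcl _ hz _ hx y (hdet y hy)).1] at this
        rw [hs _ (by simp), ← this]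
        congr 1
        exact codeOf_congr (fun _ _ => rfl)
          fun v hv => (read_map h (hclsub _ hz _ hx v hv)).symm
  obtain ⟨n, s, hexec, hn, N, Lo, hc, hout, hLo, hLo', hdec⟩ := hrun
  have hJ : IsCoded Z I (fun R => (Lo R).toFinset) fun x => codeOf N (cl x) := fun R t => by
    rw [List.mem_toFinset]
    exact mem_transfer_iff (args := extArgs)
      (G := fun z h => z.1.args.map fun x => codeOf N (cl x) h) hL hLo hLo'
      fun z hz h h' hh => List.map_congr_left fun x hx => hc.congr x h h' fun y hxy =>
        hh y (hcl z hz x (mem_extArgs hx) y hxy).1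
  have hnd : ∀ S, (Lo S).Nodup := by
    refine nodup_transfer (args := extArgs)
      (G := fun z h => z.1.args.map fun x => codeOf N (cl x) h) hL hLo hLo' ?_
    intro z hz h h' hh hh' he y hy
    obtain ⟨x, hx, hxy⟩ := (hP.derives z hz).exists_determines hy
    exact hc.inj z hz z hz x h h' (mem_extArgs hx) (mem_extArgs hx) hh hh'
      (List.map_inj_left.1 he x hx) y hxy
  let τ : Q.Answer → Q'.Answer := fun q y => s.mem (dec y) (q ⟨src y, hfree y y.2⟩)
  have hans : ∀ q ∈ Q.answers fun R => (Lo R).toFinset, ∃ h, Q'.IsHom I h ∧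
      (∀ x : Q.free, q x = codeOf N (cl x) h) ∧ ∀ y : Q'.free, τ q y = h y := by
    rintro q ⟨g, hg, hq⟩
    obtain ⟨h, hh, hgh⟩ := hP.exists_isHom_of_isCoded hc hJ hg
    have hqx : ∀ x : Q.free, q x = codeOf N (cl x) h := fun x => by
      obtain ⟨z, hz, hx⟩ := hP.safe x x.2
      rw [hq, hgh z hz x hx]
    refine ⟨h, hh, hqx, fun y => ?_⟩
    simp only [τ, hqx]
    exact hdec y y.2 h hh
  refine ⟨fun R => (Lo R).toFinset, n, s, τ, hP.over_of_isCoded hJ,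
    hP.satisfies_of_isCoded hc hJ, hexec,
    hn.trans (Nat.mul_le_mul_right _ (Nat.le_add_right _ _)), outputs_of_hasOutput hout hnd,
    ⟨?_, ?_, ?_⟩, ?_, ?_⟩
  · intro q hq
    obtain ⟨h, hh, -, hτ⟩ := hans q hq
    exact ⟨h, hh, hτ⟩
  · intro q₁ hq₁ q₂ hq₂ he
    obtain ⟨h₁, -, hx₁, hτ₁⟩ := hans q₁ hq₁
    obtain ⟨h₂, -, hx₂, hτ₂⟩ := hans q₂ hq₂
    funext x
    rw [hx₁, hx₂]
    refine hc.congr x h₁ h₂ fun y hxy => ?_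
    have hy := hP.mem_free_of_determines hxy (hP.free_subset x.2)
    rw [← hτ₁ ⟨y, hy⟩, ← hτ₂ ⟨y, hy⟩, he]
  · rintro q' ⟨h, hh, hq'⟩
    refine ⟨fun x => codeOf N (cl x) h, ⟨_, hP.isHom_of_isCoded hJ hh, fun _ => rfl⟩, ?_⟩
    funext y
    rw [hq']
    exact hdec y y.2 h hh
  · intro q hq s' hs' hin
    obtain ⟨m, s'', h₁, h₂, h₃⟩ := computesAnswer_seqs (Q := Q') (Q' := Q)
      (fun y => .load (.ansOut y) (dec y) (.ansIn (src y))) (by simp) (by simp) (by simp) s.mem q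
      (τ q) (fun y s' hs' hs => by
        have := hs ⟨src y, hfree y y.2⟩
        simp only at this
        simp [State.setReg_reg, τ, this, hs']) s' hs' hin
    exact ⟨m, s'', h₁, h₂.trans (Nat.le_add_left _ _), h₃⟩
  · intro w
    refine ⟨fun x a => ∑ y ∈ Q'.free with src y = x, w y (s.mem (dec y) a), fun q hq => ?_⟩
    obtain ⟨h, hh, hx, hτ⟩ := hans q hq
    rw [CQ.weight_eq_sum hτ, CQ.weight_eq_sum (h := fun x => codeOf N (cl x) h) hx,
      ← Finset.sum_fiberwise_of_maps_to (g := src) (t := Q.free) hfree]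
    refine Finset.sum_congr rfl fun x _ => Finset.sum_congr rfl fun y hy => ?_
    obtain ⟨hyf, rfl⟩ := Finset.mem_filter.1 hy
    rw [hdec y hyf h hh]

end Presents

theorem theorem8 (Q : CQ) (Δ : Finset FD) (Q' : CQ) (Δ' : Finset FD)
    (hsafe : Q.Safe) (hsjf : Q.SelfJoinFree)
    (hΔ : ∀ φ ∈ Δ, φ.On Q) (hunary : ∀ φ ∈ Δ, φ.Unary)
    (hext : IsFDExtension Q Δ Q' Δ') :
    WeightPreservingExactReduction Q Δ Q' ∅ ∧ WeightPreservingExactReduction Q' ∅ Q Δ := by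
  obtain ⟨Z, hP⟩ := hext.exists_presents hsafe hsjf hΔ hunary
  exact ⟨hP.reduction_to_ext, hP.reduction_from_ext⟩
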